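/- All Lie algebras are over $\mathbb{C}$ and may be infinite-dimensional. A \emph{graded Lie algebra} is a Lie algebra $G=\bigoplus_{i\in\mathbb{Z}}G_i$ with $[G_i,G_j]\subset G_{i+j}$ that is generated by its \emph{local part} $G_{-1}\oplus G_0\oplus G_1$. An \emph{isomorphism of local parts} is a degree-preserving linear isomorphism that preserves the brackets $[G_i,G_j]\subset G_{i+j}$ with $|i|,|j|,|i+j|\le 1$. The graded Lie algebra $G$ is \emph{minimal} if for every graded Lie algebra $G'$, every isomorphism of the local part of $G'$ onto that of $G$ extends to an epimorphism $G'\to G$. For $X=(X_{ij})\in \mathrm{M}(l,l;\mathbb{C})$, the \emph{contragredient Lie algebra} $G(X)$ with Cartan matrix $X$ is the minimal graded Lie algebra whose local part has bases $\{f_i\}$ of $G_{-1}$, $\{h_i\}$ of $G_0$, $\{e_i\}$ of $G_1$ $(1\le i\le l)$ with $$[e_i,f_j]=\delta_{ij}h_i,\quad [h_i,h_j]=0,\quad [h_i,e_j]=X_{ij}e_j,\quad [h_i,f_j]=-X_{ij}f_j .$$ A \emph{standard pentad} $(\mathfrak{g},\rho,V,\mathcal{V},B_0)$ consists of a non-zero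 Lie algebra $\mathfrak{g}$ with a non-degenerate invariant bilinear form $B_0$ (not necessarily symmetric), $\mathfrak{g}$-modules $V$ and $\mathcal{V}$ with a non-degenerate invariant pairing $\langle\cdot,\cdot\rangle:V\times\mathcal{V}\to\mathbb{C}$, such that there is a linear map $\Phi:V\otimes\mathcal{V}\to\mathfrak{g}$ (the $\Phi$-map) with $B_0(a,\Phi(v\otimes\phi))=\langle \rho(a\otimes v),\phi\rangle$. The \emph{Lie algebra associated with it} is the graded Lie algebra $\bigoplus_{n\in\mathbb{Z}}V_n$, unique up to isomorphism, with $V_{-1}=\mathcal{V}$, $V_0=\mathfrak{g}$, $V_1=V$, whose local brackets are the bracket of $\mathfrak{g}$, the two actions of $\mathfrak{g}$, and $[v,\phi]=\Phi(v\otimes\phi)$, and in which $x\in V_n$ vanishes if $n\ge 2$ and $[x,V_{-1}]=0$, or if $n\le -2$ and $[x,V_1]=0$. For $r,n\ge 1$, an invertible $A\in \mathrm{M}(r,r;\mathbb{C})$, a matrix $D=(d_{ij})\in \mathrm{M}(r,n;\mathbb{C})$ and an invertible diagonal matrix $\Gamma=\mathrm{diag}(\gamma_1,\dots,\gamma_n)$,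 the \emph{PC Lie algebra} $L(r,n;A,D,\Gamma)$ is the Lie algebra associated with the following pentad: $\mathfrak{g}=\mathbb{C}^r$ is commutative with standard basis $\epsilon_1,\dots,\epsilon_r$; $B_0(c,c')=c\cdot{}^tA^{-1}\cdot{}^tc'$; $V=\mathcal{V}=\mathbb{C}^n$ as vector spaces with standard bases $e_j$ and $f_j$, $\epsilon_i e_j=d_{ij}e_j$, $\epsilon_i f_j=-d_{ij}f_j$, and $\langle e_i,f_j\rangle=\delta_{ij}\gamma_i$. \textbf{Theorem.} Let $l\ge 1$ and let $X\in \mathrm{M}(l,l;\mathbb{C})$ be invertible. The contragredient Lie algebra $G(X)$ and the PC Lie algebra $L(l,l;X,I_l,I_l)$ exist, and there is an isomorphism of Lie algebras $G(X)\simeq L(l,l;X,I_l,I_l)$ (for every $G(X)$ and every $L(l,l;X,I_l,I_l)$ as defined above). In particular, suppose that $X$ is an invertible generalized Cartan matrix: $X_{ii}=2$, $X_{ij}\in\mathbb{Z}_{\le 0}$ for $i\ne j$, and $X_{ij}=0$ implies $X_{ji}=0$. Let $\mathfrak{g}(X)=\tilde{\mathfrak{g}}'(X)/\mathfrak{r}$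 be the Kac--Moody Lie algebra, where $\tilde{\mathfrak{g}}'(X)$ is the Lie algebra on generators $e_i,f_i,\alpha_i^\vee$ with the relations displayed above (with $\alpha_i^\vee$ for $h_i$), graded by $\mathbb{Z}^l$ with $\deg e_i=-\deg f_i$ the $i$-th unit vector and $\deg\alpha_i^\vee=0$, and $\mathfrak{r}$ is its largest graded ideal that intersects $\sum_i\mathbb{C}\alpha_i^\vee$ trivially. Then $\mathfrak{g}(X)\simeq L(l,l;X,I_l,I_l)$ as Lie algebras. -/

import Mathlib

universe u

noncomputable section

namespace PentadLie

/-! ### Graded Lie algebras, local parts, minimality -/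

section Graded

variable {G : Type u} [LieRing G] [LieAlgebra ℂ G]

/-- The local part `G₋₁ ⊕ G₀ ⊕ G₁` of a family of subspaces indexed by the integers. -/
def localPart (𝒢 : ℤ → Submodule ℂ G) : Submodule ℂ G :=
  𝒢 (-1) ⊔ 𝒢 0 ⊔ 𝒢 1

/-- `𝒢` makes `G` a graded Lie algebra: `G = ⨁ 𝒢 i`, `[𝒢 i, 𝒢 j] ⊆ 𝒢 (i + j)`, and `G` is
generated, as a Lie algebra, by its local part. The components may be infinite-dimensional. -/
structure IsGradedLieAlgebra (𝒢 : ℤ → Submodule ℂ G) : Prop where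
  isInternal : DirectSum.IsInternal 𝒢
  lie_mem : ∀ i j : ℤ, ∀ x ∈ 𝒢 i, ∀ y ∈ 𝒢 j, ⁅x, y⁆ ∈ 𝒢 (i + j)
  generates : LieSubalgebra.lieSpan ℂ G (localPart 𝒢 : Set G) = ⊤

/-- An isomorphism of local parts, as local Lie algebras: a linear isomorphism that maps the
component of degree `i` onto the component of degree `i` for `i = -1, 0, 1` and preserves the
brackets `[x, y]` with `x`, `y`, `[x, y]` of degrees `i`, `j`, `i + j` in `{-1, 0, 1}`
(these are the brackets that a local Lie algebra has). -/
structure IsLocalIso {G' : Type u} [LieRing G'] [LieAlgebra ℂ G']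
    (𝒢' : ℤ → Submodule ℂ G') (𝒢 : ℤ → Submodule ℂ G)
    (ψ : localPart 𝒢' ≃ₗ[ℂ] localPart 𝒢) : Prop where
  mem_iff : ∀ i : ℤ, |i| ≤ 1 → ∀ x : localPart 𝒢', (x : G') ∈ 𝒢' i ↔ (ψ x : G) ∈ 𝒢 i
  map_lie : ∀ i j : ℤ, |i| ≤ 1 → |j| ≤ 1 → |i + j| ≤ 1 →
    ∀ x y z : localPart 𝒢', (x : G') ∈ 𝒢' i → (y : G') ∈ 𝒢' j →
      (z : G') = ⁅(x : G'), (y : G')⁆ → (ψ z : G) = ⁅(ψ x : G), (ψ y : G)⁆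

/-- The graded Lie algebra `G = ⨁ 𝒢 i` is minimal: for every graded Lie algebra `G'`, every
isomorphism of the local parts of `G'` and `G` extends to an epimorphism of `G'` onto `G`. -/
def IsMinimalGraded (𝒢 : ℤ → Submodule ℂ G) : Prop :=
  ∀ (G' : Type u) [LieRing G'] [LieAlgebra ℂ G'] (𝒢' : ℤ → Submodule ℂ G'),
    IsGradedLieAlgebra 𝒢' →
    ∀ ψ : localPart 𝒢' ≃ₗ[ℂ] localPart 𝒢, IsLocalIso 𝒢' 𝒢 ψ →
      ∃ f : G' →ₗ⁅ℂ⁆ G, Function.Surjective f ∧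
        ∀ x : localPart 𝒢', f (x : G') = (ψ x : G)

end Graded

/-! ### Contragredient Lie algebras -/

/-- `G` is a contragredient Lie algebra `G(A)` with Cartan matrix `A`: it is the minimal graded
Lie algebra whose local part has bases `f i` of `G₋₁`, `h i` of `G₀`, `e i` of `G₁` with
`[e i, f j] = δ i j h i`, `[h i, h j] = 0`, `[h i, e j] = A i j e j`,
`[h i, f j] = - A i j f j`. -/
def IsContragredient {n : ℕ} (A : Matrix (Fin n) (Fin n) ℂ)
    (G : Type u) [LieRing G] [LieAlgebra ℂ G] : Prop :=
  ∃ 𝒢 : ℤ → Submodule ℂ G, IsGradedLieAlgebra 𝒢 ∧ IsMinimalGraded 𝒢 ∧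
    ∃ (f : Module.Basis (Fin n) ℂ (𝒢 (-1))) (h : Module.Basis (Fin n) ℂ (𝒢 0))
      (e : Module.Basis (Fin n) ℂ (𝒢 1)),
      (∀ i j, ⁅(e i : G), (f j : G)⁆ = if i = j then (h i : G) else 0) ∧
      (∀ i j, ⁅(h i : G), (h j : G)⁆ = 0) ∧
      (∀ i j, ⁅(h i : G), (e j : G)⁆ = A i j • (e j : G)) ∧
      (∀ i j, ⁅(h i : G), (f j : G)⁆ = -(A i j • (f j : G)))

/-! ### Standard pentads and their Lie algebras -/

section Pentad

variable {𝔤 V W : Type} [LieRing 𝔤] [LieAlgebra ℂ 𝔤]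
  [AddCommGroup V] [Module ℂ V] [LieRingModule 𝔤 V] [LieModule ℂ 𝔤 V]
  [AddCommGroup W] [Module ℂ W] [LieRingModule 𝔤 W] [LieModule ℂ 𝔤 W]

/-- `Φ` is the `Φ`-map of the pentad `(𝔤, V, W, B)`, where `W` is paired with `V` by `pair`. -/
def IsPhiMap (pair : V →ₗ[ℂ] W →ₗ[ℂ] ℂ) (B : 𝔤 →ₗ[ℂ] 𝔤 →ₗ[ℂ] ℂ)
    (Φ : V →ₗ[ℂ] W →ₗ[ℂ] 𝔤) : Prop :=
  ∀ (a : 𝔤) (v : V) (φ : W), B a (Φ v φ) = pair ⁅a, v⁆ φ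

/-- The pentad `(𝔤, V, W, B)` is standard: `𝔤` is a non-zero Lie algebra with a non-degenerate
invariant bilinear form `B` (not assumed to be symmetric), `V` and `W` are `𝔤`-modules, `W` is
identified with a submodule of the dual module of `V` by the invariant pairing `pair`, which is
non-degenerate, and a `Φ`-map exists. -/
structure IsStandardPentad (pair : V →ₗ[ℂ] W →ₗ[ℂ] ℂ) (B : 𝔤 →ₗ[ℂ] 𝔤 →ₗ[ℂ] ℂ) : Prop where
  nontrivial : Nontrivial 𝔤
  form_left : ∀ a, (∀ b, B a b = 0) → a = 0
  form_right : ∀ b, (∀ a, B a b = 0) → b = 0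
  form_invariant : ∀ a b c : 𝔤, B ⁅a, b⁆ c = B a ⁅b, c⁆
  pair_invariant : ∀ (a : 𝔤) (v : V) (φ : W), pair ⁅a, v⁆ φ = -pair v ⁅a, φ⁆
  pair_left : ∀ v, (∀ φ, pair v φ = 0) → v = 0
  pair_right : ∀ φ, (∀ v, pair v φ = 0) → φ = 0
  exists_phi : ∃ Φ : V →ₗ[ℂ] W →ₗ[ℂ] 𝔤, IsPhiMap pair B Φ

/-- `L` is the Lie algebra `L(𝔤, V, W, B)` associated with the standard pentad: it is a graded Lie
algebra `⨁ ℒ i` whose local part is `W ⊕ 𝔤 ⊕ V` (in degrees `-1`, `0`, `1`), with the brackets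
given by the bracket of `𝔤`, the two module structures and the `Φ`-map, and in which an `x` of
degree `i ≥ 2` (resp. `i ≤ -2`) with `[x, ℒ (-1)] = 0` (resp. `[x, ℒ 1] = 0`) vanishes.
These properties determine `L` up to isomorphism. -/
def IsAssociatedLieAlgebra (pair : V →ₗ[ℂ] W →ₗ[ℂ] ℂ) (B : 𝔤 →ₗ[ℂ] 𝔤 →ₗ[ℂ] ℂ)
    (L : Type u) [LieRing L] [LieAlgebra ℂ L] : Prop :=
  IsStandardPentad pair B ∧
  ∃ ℒ : ℤ → Submodule ℂ L, IsGradedLieAlgebra ℒ ∧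
    (∃ (ιW : W ≃ₗ[ℂ] ℒ (-1)) (ι𝔤 : 𝔤 ≃ₗ[ℂ] ℒ 0) (ιV : V ≃ₗ[ℂ] ℒ 1),
      (∀ a b : 𝔤, ⁅(ι𝔤 a : L), (ι𝔤 b : L)⁆ = ι𝔤 ⁅a, b⁆) ∧
      (∀ (a : 𝔤) (v : V), ⁅(ι𝔤 a : L), (ιV v : L)⁆ = ιV ⁅a, v⁆) ∧
      (∀ (a : 𝔤) (φ : W), ⁅(ι𝔤 a : L), (ιW φ : L)⁆ = ιW ⁅a, φ⁆) ∧
      (∃ Φ : V →ₗ[ℂ] W →ₗ[ℂ] 𝔤, IsPhiMap pair B Φ ∧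
        ∀ (v : V) (φ : W), ⁅(ιV v : L), (ιW φ : L)⁆ = ι𝔤 (Φ v φ))) ∧
    (∀ i : ℤ, 2 ≤ i → ∀ x ∈ ℒ i, (∀ y ∈ ℒ (-1), ⁅x, y⁆ = 0) → x = 0) ∧
    (∀ i : ℤ, i ≤ -2 → ∀ x ∈ ℒ i, (∀ y ∈ ℒ 1, ⁅x, y⁆ = 0) → x = 0)

end Pentad

/-! ### Pentads of Cartan type -/

/-- The commutative Lie algebra `𝔥^r = 𝔤𝔩₁^r = ℂ^r`. -/
def CartanAlgebra (r : ℕ) : Type := Fin r → ℂ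

instance (r : ℕ) : AddCommGroup (CartanAlgebra r) := inferInstanceAs (AddCommGroup (Fin r → ℂ))

instance (r : ℕ) : Module ℂ (CartanAlgebra r) := inferInstanceAs (Module ℂ (Fin r → ℂ))

instance (r : ℕ) : LieRing (CartanAlgebra r) where
  bracket _ _ := 0
  add_lie _ _ _ := (add_zero _).symm
  lie_add _ _ _ := (add_zero _).symm
  lie_self _ := rfl
  leibniz_lie _ _ _ := (add_zero _).symm

instance (r : ℕ) : LieAlgebra ℂ (CartanAlgebra r) where
  lie_smul t _ _ := (smul_zero t).symm

/-- The space `ℂ^n`, on which the `i`-th basis vector of `𝔥^r` acts on the `j`-th basis vector as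
multiplication by the entry `D i j`. So `CartanModule (-D)` is the module in which it acts by
`-D i j`. -/
def CartanModule {r n : ℕ} (_D : Matrix (Fin r) (Fin n) ℂ) : Type := Fin n → ℂ

section CartanModule

variable {r n : ℕ} (D : Matrix (Fin r) (Fin n) ℂ)

instance : AddCommGroup (CartanModule D) := inferInstanceAs (AddCommGroup (Fin n → ℂ))

instance : Module ℂ (CartanModule D) := inferInstanceAs (Module ℂ (Fin n → ℂ))

instance : LieRingModule (CartanAlgebra r) (CartanModule D) where
  bracket c v := fun j => (∑ i, c i * D i j) * v j
  add_lie a b v := by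
    funext j
    change (∑ i, (a i + b i) * D i j) * v j =
      (∑ i, a i * D i j) * v j + (∑ i, b i * D i j) * v j
    simp only [add_mul, Finset.sum_add_distrib]
  lie_add a v w := by
    funext j
    exact mul_add _ (v j) (w j)
  leibniz_lie a b v := by
    funext j
    change (∑ i, a i * D i j) * ((∑ i, b i * D i j) * v j) =
      (∑ i, (0 : ℂ) * D i j) * v j + (∑ i, b i * D i j) * ((∑ i, a i * D i j) * v j)
    simp only [zero_mul, Finset.sum_const_zero, zero_add]
    ring

instance : LieModule ℂ (CartanAlgebra r) (CartanModule D) where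
  smul_lie t a v := by
    funext j
    change (∑ i, (t * a i) * D i j) * v j = t * ((∑ i, a i * D i j) * v j)
    simp only [mul_assoc, ← Finset.mul_sum]
  lie_smul t a v := by
    funext j
    change (∑ i, a i * D i j) * (t * v j) = t * ((∑ i, a i * D i j) * v j)
    ring

end CartanModule

/-- The bilinear form `B_A(c, c') = c · ᵗA⁻¹ · ᵗc'` on `𝔥^r`. -/
def cartanForm {r : ℕ} (A : Matrix (Fin r) (Fin r) ℂ) :
    CartanAlgebra r →ₗ[ℂ] CartanAlgebra r →ₗ[ℂ] ℂ :=
  (Matrix.toLinearMap₂' ℂ (A.transpose⁻¹) : (Fin r → ℂ) →ₗ[ℂ] (Fin r → ℂ) →ₗ[ℂ] ℂ)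

/-- The pairing of `ℂ_D^Γ` and `ℂ_{-D}^Γ`, with `⟨e i, f j⟩ = Γ i j` on the standard bases. -/
def cartanPairing {r n : ℕ} (D : Matrix (Fin r) (Fin n) ℂ) (Γ : Matrix (Fin n) (Fin n) ℂ) :
    CartanModule D →ₗ[ℂ] CartanModule (-D) →ₗ[ℂ] ℂ :=
  (Matrix.toLinearMap₂' ℂ Γ : (Fin n → ℂ) →ₗ[ℂ] (Fin n → ℂ) →ₗ[ℂ] ℂ)

/-- `L` is the PC Lie algebra `L(r, n; A, D, Γ)`: the data `r, n ≥ 1`, `A` invertible and `Γ`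
invertible diagonal define a pentad of Cartan type `P(r, n; A, D, Γ)`, and `L` is the Lie algebra
associated with it. -/
def IsPCLieAlgebra (r n : ℕ) (A : Matrix (Fin r) (Fin r) ℂ) (D : Matrix (Fin r) (Fin n) ℂ)
    (Γ : Matrix (Fin n) (Fin n) ℂ) (L : Type u) [LieRing L] [LieAlgebra ℂ L] : Prop :=
  1 ≤ r ∧ 1 ≤ n ∧ IsUnit A ∧ Γ.IsDiag ∧ IsUnit Γ ∧
    IsAssociatedLieAlgebra (cartanPairing D Γ) (cartanForm A) L

/-! ### Kac-Moody Lie algebras with an invertible Cartan matrix -/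

/-- Generalized Cartan matrices. -/
structure IsGeneralizedCartanMatrix {n : ℕ} (A : Matrix (Fin n) (Fin n) ℂ) : Prop where
  diag : ∀ i, A i i = 2
  off_diag : ∀ i j, i ≠ j → ∃ m : ℕ, A i j = -(m : ℂ)
  zero_symm : ∀ i j, A i j = 0 → A j i = 0

section KacMoody

/-- The generators `e i`, `f i` and the simple coroots `h i`. -/
inductive Gen (n : ℕ) : Type
  | e : Fin n → Gen n
  | f : Fin n → Gen n
  | h : Fin n → Gen n

open Gen FreeLieAlgebra in
/-- The elements of the free Lie algebra that are made zero by the defining relations. -/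
inductive KMRel {n : ℕ} (A : Matrix (Fin n) (Fin n) ℂ) : FreeLieAlgebra ℂ (Gen n) → Prop
  | ef_same (i : Fin n) : KMRel A (⁅of ℂ (e i), of ℂ (f i)⁆ - of ℂ (h i))
  | ef_ne (i j : Fin n) : i ≠ j → KMRel A ⁅of ℂ (e i), of ℂ (f j)⁆
  | hh (i j : Fin n) : KMRel A ⁅of ℂ (h i), of ℂ (h j)⁆
  | he (i j : Fin n) : KMRel A (⁅of ℂ (h i), of ℂ (e j)⁆ - A i j • of ℂ (e j))
  | hf (i j : Fin n) : KMRel A (⁅of ℂ (h i), of ℂ (f j)⁆ + A i j • of ℂ (f j))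

/-- The Lie algebra on the generators `e i`, `f i`, `h i` with the defining relations
`[e i, f j] = δ i j h i`, `[h i, h j] = 0`, `[h i, e j] = A i j e j`,
`[h i, f j] = - A i j f j`. -/
abbrev KMTilde {n : ℕ} (A : Matrix (Fin n) (Fin n) ℂ) : Type :=
  FreeLieAlgebra ℂ (Gen n) ⧸
    LieSubmodule.lieSpan ℂ (FreeLieAlgebra ℂ (Gen n)) {x | KMRel A x}

variable {n : ℕ} (A : Matrix (Fin n) (Fin n) ℂ)

/-- The image of a generator. -/
def KMTilde.gen (x : Gen n) : KMTilde A :=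
  LieSubmodule.Quotient.mk (FreeLieAlgebra.of ℂ x)

/-- `HasRootDegree A α x`: `x` is an iterated bracket of generators of degree `∑ α i • α_i` in the
root lattice, where `deg e i = α_i = - deg f i` and `deg h i = 0`. -/
inductive HasRootDegree : (Fin n → ℤ) → KMTilde A → Prop
  | e (i : Fin n) : HasRootDegree (Pi.single i 1) (KMTilde.gen A (Gen.e i))
  | f (i : Fin n) : HasRootDegree (-Pi.single i 1) (KMTilde.gen A (Gen.f i))
  | h (i : Fin n) : HasRootDegree 0 (KMTilde.gen A (Gen.h i))
  | lie (α β : Fin n → ℤ) (x y : KMTilde A) :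
      HasRootDegree α x → HasRootDegree β y → HasRootDegree (α + β) ⁅x, y⁆

/-- The component of degree `α` in the gradation by the root lattice. -/
def rootComponent (α : Fin n → ℤ) : Submodule ℂ (KMTilde A) :=
  Submodule.span ℂ {x | HasRootDegree A α x}

/-- The subspace `𝔥` spanned by the simple coroots. -/
def corootSpan : Submodule ℂ (KMTilde A) :=
  Submodule.span ℂ (Set.range fun i => KMTilde.gen A (Gen.h i))

/-- An ideal is graded when it is the sum of its intersections with the components. -/
def IsRootGraded (I : LieIdeal ℂ (KMTilde A)) : Prop :=
  I.toSubmodule = ⨆ α : Fin n → ℤ, I.toSubmodule ⊓ rootComponent A α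

/-- The largest graded ideal that intersects `𝔥` trivially: the sum of all of them. -/
def kmRadical : LieIdeal ℂ (KMTilde A) :=
  sSup {I : LieIdeal ℂ (KMTilde A) | IsRootGraded A I ∧ I.toSubmodule ⊓ corootSpan A = ⊥}

/-- The Kac-Moody Lie algebra `𝔤(A)`, for an invertible generalized Cartan matrix `A`. (For such
`A` the simple coroots span the Cartan subalgebra, so no further generators are needed.) -/
abbrev KacMoody : Type := KMTilde A ⧸ kmRadical A

end KacMoody

end PentadLie

end

/-!
For invertible `X` the contragredient Lie algebra, the PC Lie algebra and the Kac–Moody Lie algebra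
are all the quotient of one algebra, `KMTilde X`, by one ideal, `kmRadical X`; the theorem compares
kernels of epimorphisms from `KMTilde X`.

Each of them is generated by elements `e i`, `f i`, `h i` satisfying the contragredient relations
(`IsChevalley`), hence receives an epimorphism from `KMTilde X` (`IsChevalley.tildeHom`). In the PC
Lie algebra, `h i` is the element of `ℂ^l` given by the `i`-th row of `X`: it is the value of the
`Φ`-map on `e i ⊗ f i` (`isPhiMap_stdBasis`).

Invertibility of `X` provides, for every weight `d`, a combination of the `h i` whose adjoint action
multiplies `e j` by `d j` and `f j` by `-d j`. So both the gradation by the integers (`component`)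
and the gradation by the root lattice consist of eigenspaces of inner derivations, and every ideal
is graded (`isRootGraded`). The triangular decomposition shows that degree zero is spanned by the
`h i`. Therefore the sum of all ideals that meet the span of the `h i` trivially is again such an
ideal (`kmRadical_inf_corootSpan`), and the kernel of an epimorphism onto an algebra in which the
`h i` are independent lies in the radical (`IsChevalley.ker_le_kmRadical`). That the `h i` are
independent in `KMTilde X` itself is seen in a representation on words (`linearIndependent_tilde`).

The reverse inclusion of the radical in the kernel says that the algebra is reduced: no non-zero
ideal meets the span of the `h i` trivially. This follows from transitivity, which the PC Lie
algebra has by definition: an ideal without part of degree zero vanishes degree by degree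
(`IsChevalley.isReduced_of_transitive`). Conversely, an element of a reduced algebra violating
transitivity would generate an ideal without part of degree zero
(`IsChevalley.eq_zero_of_lie_f_eq_zero`), so the quotient by the radical is a PC Lie algebra. The
quotient is minimal, because any graded Lie algebra with the same local part is a quotient of
`KMTilde X` by a smaller ideal (`IsChevalley.isMinimalGraded`). For an arbitrary contragredient Lie
algebra, its own minimality, applied to the quotient by the radical, gives the reverse inclusion
(`IsContragredient.exists_isChevalley`).
-/

noncomputable section

namespace PentadLie

/-! ### Decompositions into eigenspaces -/

section Eigenspaces

variable {V ι : Type*} [AddCommGroup V] [Module ℂ V] {T : Module.End ℂ V}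
  {W : ι → Submodule ℂ V} {χ : ι → ℂ}

lemma iSupIndep_of_le_eigenspace (hχ : Function.Injective χ)
    (hW : ∀ i, W i ≤ T.eigenspace (χ i)) : iSupIndep W :=
  (T.eigenspaces_iSupIndep.comp hχ).mono hW

/-- Eigenspaces are independent, so subspaces of them that span everything exhaust them. -/
lemma eigenspace_eq_of_iSup_eq_top (hχ : Function.Injective χ)
    (hW : ∀ i, W i ≤ T.eigenspace (χ i)) (htop : ⨆ i, W i = ⊤) (i : ι) :
    T.eigenspace (χ i) = W i := by
  have := ((T.eigenspaces_iSupIndep.comp hχ).le_iff_eq_of_iSup_eq_top htop).1 hW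
  exact (congrFun this i).symm

/-- A subspace stable under a diagonalizable operator is the sum of its intersections with the
eigenspaces; the dimension may be infinite. -/
lemma eq_iSup_inf_of_stable (hχ : Function.Injective χ)
    (hW : ∀ i, W i ≤ T.eigenspace (χ i)) (htop : ⨆ i, W i = ⊤)
    (p : Submodule ℂ V) (hp : ∀ x ∈ p, T x ∈ p) : p = ⨆ i, p ⊓ W i := by
  refine le_antisymm (fun x hx => ?_) (iSup_le fun i => inf_le_left)
  obtain ⟨f, hf, rfl⟩ := (Submodule.mem_iSup_iff_exists_finsupp W x).1 (htop ▸ Submodule.mem_top)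
  -- In `V ⧸ p` the images of the components are eigenvectors for distinct eigenvalues whose sum
  -- is zero, hence they vanish.
  have hT : p ≤ p.comap T := hp
  have hind := (iSupIndep_iff_finsetSum_eq_zero_imp_eq_zero _).1
    ((Module.End.eigenspaces_iSupIndep (p.mapQ p T hT)).comp hχ) f.support (fun i => p.mkQ (f i))
    (fun i _ => by
      have := Module.End.mem_eigenspace_iff.1 (hW i (hf i))
      refine Module.End.mem_eigenspace_iff.2 ?_
      rw [Submodule.mkQ_apply, Submodule.mapQ_apply, this]
      rfl)
    (by
      rw [← map_sum]
      exact (Submodule.Quotient.mk_eq_zero p).2 hx)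
  refine Submodule.sum_mem _ fun i hi => ?_
  exact Submodule.mem_iSup_of_mem i ⟨(Submodule.Quotient.mk_eq_zero p).1 (hind i hi), hf i⟩

end Eigenspaces

/-- For every `n` there are weights `d` whose integral combinations are pairwise distinct. -/
lemma exists_injective_weights (n : ℕ) :
    ∃ d : Fin n → ℂ, Function.Injective fun α : Fin n → ℤ => ∑ i, (α i : ℂ) * d i := by
  obtain ⟨d, hd⟩ := exists_linearIndependent_of_le_rank (R := ℚ) (M := ℂ) (n := n) (by
    rw [Complex.rank_rat_complex]
    exact (Cardinal.natCast_lt_aleph0).le.trans Cardinal.aleph0_le_continuum)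
  refine ⟨d, fun α β h => funext fun i => ?_⟩
  have := Fintype.linearIndependent_iff.1 hd (fun i => ((α i : ℚ) - β i)) (by
    simp only [sub_smul, Finset.sum_sub_distrib, Rat.smul_def]
    rw [sub_eq_zero]
    simpa using h) i
  exact_mod_cast sub_eq_zero.1 this

/-! ### Generators satisfying the contragredient relations -/

section Chevalley

variable {n : ℕ} {M : Type*} [LieRing M] [LieAlgebra ℂ M]

/-- The elements `e i`, `f i`, `h i` generate the Lie algebra `M` and satisfy the defining
relations of the contragredient Lie algebra with Cartan matrix `X`. -/
structure IsChevalley (X : Matrix (Fin n) (Fin n) ℂ) (e f h : Fin n → M) : Prop where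
  e_f : ∀ i j, ⁅e i, f j⁆ = if i = j then h i else 0
  h_h : ∀ i j, ⁅h i, h j⁆ = 0
  h_e : ∀ i j, ⁅h i, e j⁆ = X i j • e j
  h_f : ∀ i j, ⁅h i, f j⁆ = -(X i j • f j)
  generates : LieSubalgebra.lieSpan ℂ M (Set.range e ∪ Set.range f ∪ Set.range h) = ⊤

/-- The element of the span of the `h i` that acts on `e j` by the weight `d j`. -/
def weightElement (X : Matrix (Fin n) (Fin n) ℂ) (h : Fin n → M) (d : Fin n → ℂ) : M :=
  ∑ i, Matrix.vecMul d X⁻¹ i • h i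

/-- The component of degree `k` in the gradation with `e i`, `h i`, `f i` in degrees `1`, `0`,
`-1`, as an eigenspace of an inner derivation. -/
def component (X : Matrix (Fin n) (Fin n) ℂ) (h : Fin n → M) (k : ℤ) : Submodule ℂ M :=
  (LieAlgebra.ad ℂ M (weightElement X h 1)).eigenspace (k : ℂ)

lemma mem_component {X : Matrix (Fin n) (Fin n) ℂ} {h : Fin n → M} {k : ℤ} {x : M} :
    x ∈ component X h k ↔ ⁅weightElement X h 1, x⁆ = (k : ℂ) • x := by
  rw [component, Module.End.mem_eigenspace_iff, LieAlgebra.ad_apply]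

lemma component_neg (X : Matrix (Fin n) (Fin n) ℂ) (h : Fin n → M) (k : ℤ) :
    component X (-h) k = component X h (-k) := by
  ext x
  have : weightElement X (-h) 1 = -weightElement X h 1 := by simp [weightElement]
  rw [mem_component, mem_component, this, neg_lie, Int.cast_neg, neg_smul, neg_eq_iff_eq_neg]

lemma lie_lie_eq_smul {a x y : M} {s t : ℂ} (hx : ⁅a, x⁆ = s • x) (hy : ⁅a, y⁆ = t • y) :
    ⁅a, ⁅x, y⁆⁆ = (s + t) • ⁅x, y⁆ := by
  rw [leibniz_lie, hx, hy, smul_lie, lie_smul, ← add_smul]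

lemma lie_mem_component {X : Matrix (Fin n) (Fin n) ℂ} {h : Fin n → M} {i j : ℤ} {x y : M}
    (hx : x ∈ component X h i) (hy : y ∈ component X h j) : ⁅x, y⁆ ∈ component X h (i + j) := by
  rw [mem_component] at *
  rw [lie_lie_eq_smul hx hy, Int.cast_add]

/-- The span of the brackets `[v i₁, [v i₂, …, [v iₖ, v i₀]]]` with `k + 1` entries. -/
def iteratedBrackets (v : Fin n → M) : ℕ → Submodule ℂ M
  | 0 => Submodule.span ℂ (Set.range v)
  | k + 1 => ⨆ i, (iteratedBrackets v k).map (LieAlgebra.ad ℂ M (v i))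

lemma lie_mem_iteratedBrackets (v : Fin n → M) (i : Fin n) {k : ℕ} {x : M}
    (hx : x ∈ iteratedBrackets v k) : ⁅v i, x⁆ ∈ iteratedBrackets v (k + 1) :=
  Submodule.mem_iSup_of_mem i ⟨x, hx, rfl⟩

lemma iteratedBrackets_succ_le {v : Fin n → M} {k : ℕ} {S : Submodule ℂ M}
    (hS : ∀ i, ∀ x ∈ iteratedBrackets v k, ⁅v i, x⁆ ∈ S) : iteratedBrackets v (k + 1) ≤ S :=
  iSup_le fun i => Submodule.map_le_iff_le_comap.2 (hS i)

/-- A property of a bracket `[a, x]` that holds for `x` in a spanning set holds on the span. -/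
lemma lie_mem_of_mem_span {a x : M} {s : Set M} {S : Submodule ℂ M} (hx : x ∈ Submodule.span ℂ s)
    (hs : ∀ y ∈ s, ⁅a, y⁆ ∈ S) : ⁅a, x⁆ ∈ S :=
  (Submodule.span_le (p := S.comap (LieAlgebra.ad ℂ M a))).2 hs hx

/-- The triangular decomposition by degrees: iterated brackets of the `e i` in positive degrees,
the span of the `h i` in degree zero, iterated brackets of the `f i` in negative degrees. -/
def triangularPiece (e f h : Fin n → M) : ℤ → Submodule ℂ M
  | Int.ofNat 0 => Submodule.span ℂ (Set.range h)
  | Int.ofNat (k + 1) => iteratedBrackets e k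
  | Int.negSucc k => iteratedBrackets f k

namespace IsChevalley

variable {X : Matrix (Fin n) (Fin n) ℂ} {e f h : Fin n → M}

/-- The relations are symmetric under exchanging the `e i` with the `f i`. -/
lemma swap (c : IsChevalley X e f h) : IsChevalley X f e (-h) where
  e_f i j := by
    rw [← lie_skew, c.e_f]
    by_cases hij : i = j
    · subst hij; simp
    · simp [hij, Ne.symm hij]
  h_h i j := by simp [c.h_h]
  h_e i j := by simp [c.h_f]
  h_f i j := by simp [c.h_e]
  generates := by
    rw [eq_top_iff, ← c.generates, LieSubalgebra.lieSpan_le]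
    rintro x ((⟨i, rfl⟩ | ⟨i, rfl⟩) | ⟨i, rfl⟩)
    · exact LieSubalgebra.subset_lieSpan (Or.inl (Or.inr ⟨i, rfl⟩))
    · exact LieSubalgebra.subset_lieSpan (Or.inl (Or.inl ⟨i, rfl⟩))
    · rw [← neg_neg (h i)]
      exact neg_mem (LieSubalgebra.subset_lieSpan (Or.inr ⟨i, rfl⟩))

/-- A subspace stable under the generators is an ideal. -/
lemma lie_mem_of_stable (c : IsChevalley X e f h) {S : Submodule ℂ M}
    (he : ∀ i, ∀ x ∈ S, ⁅e i, x⁆ ∈ S) (hf : ∀ i, ∀ x ∈ S, ⁅f i, x⁆ ∈ S)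
    (hh : ∀ i, ∀ x ∈ S, ⁅h i, x⁆ ∈ S) (y x : M) (hx : x ∈ S) : ⁅y, x⁆ ∈ S := by
  have hy : y ∈ LieSubalgebra.lieSpan ℂ M (Set.range e ∪ Set.range f ∪ Set.range h) := by
    rw [c.generates]; trivial
  induction hy using LieSubalgebra.lieSpan_induction generalizing x with
  | mem y hy =>
    rcases hy with (⟨i, rfl⟩ | ⟨i, rfl⟩) | ⟨i, rfl⟩
    exacts [he i x hx, hf i x hx, hh i x hx]
  | zero => simp
  | add a b _ _ ha hb => rw [add_lie]; exact add_mem (ha x hx) (hb x hx)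
  | smul t a _ ha => rw [smul_lie]; exact S.smul_mem t (ha x hx)
  | lie a b _ _ ha hb => rw [lie_lie]; exact sub_mem (ha _ (hb x hx)) (hb _ (ha x hx))

/-- A subspace containing the generators and stable under them is everything. -/
lemma eq_top_of_stable (c : IsChevalley X e f h) {S : Submodule ℂ M}
    (he : ∀ i, ∀ x ∈ S, ⁅e i, x⁆ ∈ S) (hf : ∀ i, ∀ x ∈ S, ⁅f i, x⁆ ∈ S)
    (hh : ∀ i, ∀ x ∈ S, ⁅h i, x⁆ ∈ S) (he' : ∀ i, e i ∈ S) (hf' : ∀ i, f i ∈ S)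
    (hh' : ∀ i, h i ∈ S) : S = ⊤ := by
  let S' : LieSubalgebra ℂ M :=
    { S with lie_mem' := fun {y x} _ hx => c.lie_mem_of_stable he hf hh y x hx }
  have : LieSubalgebra.lieSpan ℂ M (Set.range e ∪ Set.range f ∪ Set.range h) ≤ S' := by
    rw [LieSubalgebra.lieSpan_le]
    rintro x ((⟨i, rfl⟩ | ⟨i, rfl⟩) | ⟨i, rfl⟩)
    exacts [he' i, hf' i, hh' i]
  rw [c.generates] at this
  exact eq_top_iff.2 fun x _ => this (LieSubalgebra.mem_top x)

/-- Lie algebra homomorphisms that agree on generators are equal. -/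
lemma hom_ext (c : IsChevalley X e f h) {N : Type*} [LieRing N] [LieAlgebra ℂ N]
    {p q : M →ₗ⁅ℂ⁆ N} (he : ∀ i, p (e i) = q (e i)) (hf : ∀ i, p (f i) = q (f i))
    (hh : ∀ i, p (h i) = q (h i)) : p = q := by
  let S : LieSubalgebra ℂ M :=
    { LinearMap.eqLocus (p : M →ₗ[ℂ] N) (q : M →ₗ[ℂ] N) with
      lie_mem' := fun {x y} (hx : p x = q x) (hy : p y = q y) => by
        change p ⁅x, y⁆ = q ⁅x, y⁆
        rw [LieHom.map_lie, LieHom.map_lie, hx, hy] }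
  have : LieSubalgebra.lieSpan ℂ M (Set.range e ∪ Set.range f ∪ Set.range h) ≤ S := by
    rw [LieSubalgebra.lieSpan_le]
    rintro x ((⟨i, rfl⟩ | ⟨i, rfl⟩) | ⟨i, rfl⟩)
    exacts [he i, hf i, hh i]
  rw [c.generates] at this
  exact LieHom.ext fun x => this (LieSubalgebra.mem_top x)

lemma surjective_of_mem_range (c : IsChevalley X e f h) {N : Type*} [LieRing N] [LieAlgebra ℂ N]
    (p : N →ₗ⁅ℂ⁆ M) (he : ∀ i, e i ∈ p.range) (hf : ∀ i, f i ∈ p.range)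
    (hh : ∀ i, h i ∈ p.range) : Function.Surjective p := by
  have : LieSubalgebra.lieSpan ℂ M (Set.range e ∪ Set.range f ∪ Set.range h) ≤ p.range := by
    rw [LieSubalgebra.lieSpan_le]
    rintro x ((⟨i, rfl⟩ | ⟨i, rfl⟩) | ⟨i, rfl⟩)
    exacts [he i, hf i, hh i]
  rw [c.generates] at this
  exact fun x => this (LieSubalgebra.mem_top x)

lemma weightElement_e (c : IsChevalley X e f h) (hX : IsUnit X) (d : Fin n → ℂ) (j : Fin n) :
    ⁅weightElement X h d, e j⁆ = d j • e j := by
  have hdet : IsUnit X.det := (Matrix.isUnit_iff_isUnit_det X).1 hX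
  have : Matrix.vecMul (Matrix.vecMul d X⁻¹) X = d := by
    rw [Matrix.vecMul_vecMul, Matrix.nonsing_inv_mul _ hdet, Matrix.vecMul_one]
  conv_rhs => rw [← this]
  simp only [weightElement, sum_lie, smul_lie, c.h_e, smul_smul, ← Finset.sum_smul]
  rfl

lemma weightElement_h (c : IsChevalley X e f h) (d : Fin n → ℂ) (j : Fin n) :
    ⁅weightElement X h d, h j⁆ = 0 := by
  simp [weightElement, sum_lie, c.h_h]

lemma weightElement_f (c : IsChevalley X e f h) (hX : IsUnit X) (d : Fin n → ℂ) (j : Fin n) :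
    ⁅weightElement X h d, f j⁆ = -(d j • f j) := by
  have : weightElement X h d = -weightElement X (-h) d := by simp [weightElement]
  rw [this, neg_lie, c.swap.weightElement_e hX]

lemma e_mem_component (c : IsChevalley X e f h) (hX : IsUnit X) (i : Fin n) :
    e i ∈ component X h 1 := by
  simp [mem_component, c.weightElement_e hX]

lemma h_mem_component (c : IsChevalley X e f h) (i : Fin n) : h i ∈ component X h 0 := by
  simp [mem_component, c.weightElement_h]

lemma f_mem_component (c : IsChevalley X e f h) (hX : IsUnit X) (i : Fin n) :
    f i ∈ component X h (-1) := by
  simp [mem_component, c.weightElement_f hX]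

lemma iteratedBrackets_le_component (c : IsChevalley X e f h) (hX : IsUnit X) (k : ℕ) :
    iteratedBrackets e k ≤ component X h (k + 1) := by
  induction k with
  | zero =>
    refine Submodule.span_le.2 ?_
    rintro _ ⟨i, rfl⟩
    simpa using c.e_mem_component hX i
  | succ k ih =>
    refine iteratedBrackets_succ_le fun i x hx => ?_
    have := lie_mem_component (c.e_mem_component hX i) (ih hx)
    rwa [add_comm, ← Nat.cast_succ] at this

lemma lie_h_mem_iteratedBrackets (c : IsChevalley X e f h) (i : Fin n) (k : ℕ) :
    ∀ x ∈ iteratedBrackets e k, ⁅h i, x⁆ ∈ iteratedBrackets e k := by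
  induction k with
  | zero =>
    refine fun x hx => lie_mem_of_mem_span hx ?_
    rintro _ ⟨j, rfl⟩
    rw [c.h_e]
    exact Submodule.smul_mem _ _ (Submodule.subset_span ⟨j, rfl⟩)
  | succ k ih =>
    refine iteratedBrackets_succ_le
      (S := (iteratedBrackets e (k + 1)).comap (LieAlgebra.ad ℂ M (h i)))
      fun j x hx => ?_
    change ⁅h i, ⁅e j, x⁆⁆ ∈ iteratedBrackets e (k + 1)
    rw [leibniz_lie, c.h_e, smul_lie]
    exact add_mem (Submodule.smul_mem _ _ (lie_mem_iteratedBrackets e j hx))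
      (lie_mem_iteratedBrackets e j (ih x hx))

lemma lie_e_mem_of_mem_span_h (c : IsChevalley X e f h) (i : Fin n) {x : M}
    (hx : x ∈ Submodule.span ℂ (Set.range h)) : ⁅e i, x⁆ ∈ iteratedBrackets e 0 := by
  refine lie_mem_of_mem_span hx ?_
  rintro _ ⟨j, rfl⟩
  rw [← lie_skew, c.h_e]
  exact neg_mem (Submodule.smul_mem _ _ (Submodule.subset_span ⟨i, rfl⟩))

lemma lie_f_mem_of_mem_span_e (c : IsChevalley X e f h) (i : Fin n) {x : M}
    (hx : x ∈ iteratedBrackets e 0) : ⁅f i, x⁆ ∈ Submodule.span ℂ (Set.range h) := by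
  refine lie_mem_of_mem_span hx ?_
  rintro _ ⟨j, rfl⟩
  rw [← lie_skew, c.e_f]
  split_ifs
  · exact neg_mem (Submodule.subset_span ⟨j, rfl⟩)
  · simp

lemma lie_f_mem_iteratedBrackets (c : IsChevalley X e f h) (i : Fin n) (k : ℕ) :
    ∀ x ∈ iteratedBrackets e (k + 1), ⁅f i, x⁆ ∈ iteratedBrackets e k := by
  induction k with
  | zero =>
    refine iteratedBrackets_succ_le
      (S := (iteratedBrackets e 0).comap (LieAlgebra.ad ℂ M (f i))) fun j x hx => ?_
    change ⁅f i, ⁅e j, x⁆⁆ ∈ iteratedBrackets e 0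
    rw [leibniz_lie, c.swap.e_f]
    refine add_mem ?_ (c.lie_e_mem_of_mem_span_h j (c.lie_f_mem_of_mem_span_e i hx))
    split_ifs
    · rw [Pi.neg_apply, neg_lie]
      exact neg_mem (c.lie_h_mem_iteratedBrackets i 0 x hx)
    · simp
  | succ k ih =>
    refine iteratedBrackets_succ_le
      (S := (iteratedBrackets e (k + 1)).comap (LieAlgebra.ad ℂ M (f i)))
      fun j x hx => ?_
    change ⁅f i, ⁅e j, x⁆⁆ ∈ iteratedBrackets e (k + 1)
    rw [leibniz_lie, c.swap.e_f]
    refine add_mem ?_ (lie_mem_iteratedBrackets e j (ih x hx))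
    split_ifs
    · rw [Pi.neg_apply, neg_lie]
      exact neg_mem (c.lie_h_mem_iteratedBrackets i _ x hx)
    · simp

lemma span_range_neg : Submodule.span ℂ (Set.range (-h)) = Submodule.span ℂ (Set.range h) := by
  rw [← Submodule.span_neg (Set.range h)]
  congr 1
  ext x
  simp only [Set.mem_neg, Set.mem_range, Pi.neg_apply]
  exact exists_congr fun i => neg_eq_iff_eq_neg

lemma triangularPiece_le_component (c : IsChevalley X e f h) (hX : IsUnit X) (k : ℤ) :
    triangularPiece e f h k ≤ component X h k := by
  match k with
  | Int.ofNat 0 =>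
    refine Submodule.span_le.2 ?_
    rintro _ ⟨i, rfl⟩
    exact c.h_mem_component i
  | Int.ofNat (k + 1) => exact c.iteratedBrackets_le_component hX k
  | Int.negSucc k =>
    have := c.swap.iteratedBrackets_le_component hX k
    rwa [component_neg] at this

lemma iSup_triangularPiece (c : IsChevalley X e f h) : ⨆ k, triangularPiece e f h k = ⊤ := by
  -- the pieces are permuted by brackets with generators
  have key : ∀ y : M, (∀ k, ∀ x ∈ triangularPiece e f h k, ∃ k',
      ⁅y, x⁆ ∈ triangularPiece e f h k') → ∀ x ∈ ⨆ k, triangularPiece e f h k,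
      ⁅y, x⁆ ∈ ⨆ k, triangularPiece e f h k := by
    intro y hy x hx
    refine (iSup_le (a := (⨆ k, triangularPiece e f h k).comap
      (LieAlgebra.ad ℂ M y)) fun k z hz => ?_) hx
    obtain ⟨k', hk'⟩ := hy k z hz
    exact Submodule.mem_iSup_of_mem k' hk'
  refine c.eq_top_of_stable (fun i => key _ fun k x hx => ?_) (fun i => key _ fun k x hx => ?_)
    (fun i => key _ fun k x hx => ?_) (fun i => ?_) (fun i => ?_) (fun i => ?_)
  · match k with
    | Int.ofNat 0 => exact ⟨1, c.lie_e_mem_of_mem_span_h i hx⟩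
    | Int.ofNat (k + 1) =>
      exact ⟨Int.ofNat (k + 2), lie_mem_iteratedBrackets e i hx⟩
    | Int.negSucc 0 =>
      refine ⟨0, ?_⟩
      have := c.swap.lie_f_mem_of_mem_span_e i hx
      rwa [span_range_neg] at this
    | Int.negSucc (k + 1) => exact ⟨Int.negSucc k, c.swap.lie_f_mem_iteratedBrackets i k x hx⟩
  · match k with
    | Int.ofNat 0 =>
      exact ⟨Int.negSucc 0, c.swap.lie_e_mem_of_mem_span_h i (by rwa [span_range_neg])⟩
    | Int.negSucc k => exact ⟨Int.negSucc (k + 1), lie_mem_iteratedBrackets f i hx⟩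
    | Int.ofNat 1 => exact ⟨0, c.lie_f_mem_of_mem_span_e i hx⟩
    | Int.ofNat (k + 2) => exact ⟨Int.ofNat (k + 1), c.lie_f_mem_iteratedBrackets i k x hx⟩
  · match k with
    | Int.ofNat 0 =>
      refine ⟨0, lie_mem_of_mem_span hx ?_⟩
      rintro _ ⟨j, rfl⟩
      rw [c.h_h]
      exact zero_mem _
    | Int.ofNat (k + 1) => exact ⟨Int.ofNat (k + 1), c.lie_h_mem_iteratedBrackets i k x hx⟩
    | Int.negSucc k =>
      refine ⟨Int.negSucc k, ?_⟩
      have := c.swap.lie_h_mem_iteratedBrackets i k x hx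
      rwa [Pi.neg_apply, neg_lie, Submodule.neg_mem_iff] at this
  · exact Submodule.mem_iSup_of_mem 1 (Submodule.subset_span ⟨i, rfl⟩)
  · exact Submodule.mem_iSup_of_mem (Int.negSucc 0) (Submodule.subset_span ⟨i, rfl⟩)
  · exact Submodule.mem_iSup_of_mem 0 (Submodule.subset_span ⟨i, rfl⟩)

lemma component_eq (c : IsChevalley X e f h) (hX : IsUnit X) (k : ℤ) :
    component X h k = triangularPiece e f h k :=
  eigenspace_eq_of_iSup_eq_top (χ := fun k : ℤ => (k : ℂ)) Int.cast_injective
    (c.triangularPiece_le_component hX) c.iSup_triangularPiece k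

lemma component_zero (c : IsChevalley X e f h) (hX : IsUnit X) :
    component X h 0 = Submodule.span ℂ (Set.range h) := c.component_eq hX 0

lemma component_one (c : IsChevalley X e f h) (hX : IsUnit X) :
    component X h 1 = Submodule.span ℂ (Set.range e) := c.component_eq hX 1

lemma component_neg_one (c : IsChevalley X e f h) (hX : IsUnit X) :
    component X h (-1) = Submodule.span ℂ (Set.range f) := c.component_eq hX (-1)

lemma iSup_component (c : IsChevalley X e f h) (hX : IsUnit X) :
    ⨆ k, component X h k = ⊤ := by
  simp_rw [c.component_eq hX]
  exact c.iSup_triangularPiece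

lemma iSupIndep_component : iSupIndep (component X h) :=
  iSupIndep_of_le_eigenspace (χ := fun k : ℤ => (k : ℂ)) Int.cast_injective fun _ => le_rfl

lemma eq_iSup_inf_component (c : IsChevalley X e f h) (hX : IsUnit X) (I : LieIdeal ℂ M) :
    I.toSubmodule = ⨆ k, I.toSubmodule ⊓ component X h k :=
  eq_iSup_inf_of_stable (χ := fun k : ℤ => (k : ℂ)) Int.cast_injective (fun _ => le_rfl)
    (c.iSup_component hX) _ fun _ hx => I.lie_mem hx

lemma isGradedLieAlgebra (c : IsChevalley X e f h) (hX : IsUnit X) :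
    IsGradedLieAlgebra (component X h) where
  isInternal := DirectSum.isInternal_submodule_of_iSupIndep_of_iSup_eq_top
    iSupIndep_component (c.iSup_component hX)
  lie_mem _ _ _ hx _ hy := lie_mem_component hx hy
  generates := by
    rw [eq_top_iff, ← c.generates]
    refine LieSubalgebra.lieSpan_mono ?_
    rintro x ((⟨i, rfl⟩ | ⟨i, rfl⟩) | ⟨i, rfl⟩)
    · exact Submodule.mem_sup_right (c.e_mem_component hX i)
    · exact Submodule.mem_sup_left (Submodule.mem_sup_left (c.f_mem_component hX i))
    · exact Submodule.mem_sup_left (Submodule.mem_sup_right (c.h_mem_component i))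

end IsChevalley

end Chevalley

/-! ### Quotients of Lie algebras by ideals -/

section Quotients

variable {L N : Type*} [LieRing L] [LieAlgebra ℂ L] [LieRing N] [LieAlgebra ℂ N]

/-- The projection of a Lie algebra onto its quotient by an ideal, as a Lie algebra
homomorphism. -/
def quotientHom (I : LieIdeal ℂ L) : L →ₗ⁅ℂ⁆ L ⧸ I :=
  { I.toSubmodule.mkQ with map_lie' := fun {_ _} => rfl }

lemma quotientHom_surjective (I : LieIdeal ℂ L) : Function.Surjective (quotientHom I) :=
  Submodule.mkQ_surjective _

lemma quotientHom_eq_zero {I : LieIdeal ℂ L} {x : L} : quotientHom I x = 0 ↔ x ∈ I :=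
  Submodule.Quotient.mk_eq_zero I.toSubmodule

/-- The homomorphism induced on the quotient by an ideal that is mapped to zero. -/
def quotientLift (I : LieIdeal ℂ L) (p : L →ₗ⁅ℂ⁆ N) (hI : I ≤ p.ker) : L ⧸ I →ₗ⁅ℂ⁆ N :=
  { I.toSubmodule.liftQ (p : L →ₗ[ℂ] N) (fun _ hx => LieHom.mem_ker.1 (hI hx)) with
    map_lie' := fun {x y} => by
      obtain ⟨x, rfl⟩ := quotientHom_surjective I x
      obtain ⟨y, rfl⟩ := quotientHom_surjective I y
      exact p.map_lie x y }

lemma quotientLift_bijective {I : LieIdeal ℂ L} {p : L →ₗ⁅ℂ⁆ N} (hp : Function.Surjective p)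
    (hI : p.ker = I) : Function.Bijective (quotientLift I p hI.ge) := by
  refine ⟨(injective_iff_map_eq_zero _).2 fun x hx => ?_, fun y => ?_⟩
  · obtain ⟨x, rfl⟩ := quotientHom_surjective I x
    exact quotientHom_eq_zero.2 (hI ▸ LieHom.mem_ker.2 hx)
  · obtain ⟨x, rfl⟩ := hp y
    exact ⟨quotientHom I x, rfl⟩

/-- The first isomorphism theorem, for a kernel given up to equality. -/
def quotientEquiv {I : LieIdeal ℂ L} {p : L →ₗ⁅ℂ⁆ N} (hp : Function.Surjective p)
    (hI : p.ker = I) : (L ⧸ I) ≃ₗ⁅ℂ⁆ N :=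
  LieEquiv.ofBijective _ (quotientLift_bijective hp hI)

end Quotients

/-! ### The contragredient relations on words -/

section Words

variable {n : ℕ} (X : Matrix (Fin n) (Fin n) ℂ)

/-- The eigenvalue of the `i`-th coroot on a word, in the lowering representation with highest
weight `(1, …, 1)`. -/
def wordWeight (i : Fin n) : List (Fin n) → ℂ
  | [] => 1
  | j :: w => wordWeight i w - X i j

/-- The `j`-th lowering operator prepends the letter `j`. -/
def wordF (j : Fin n) : Module.End ℂ (List (Fin n) →₀ ℂ) :=
  Finsupp.lmapDomain ℂ ℂ (List.cons j)

/-- The `i`-th coroot acts diagonally on words. -/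
def wordH (i : Fin n) : Module.End ℂ (List (Fin n) →₀ ℂ) :=
  Finsupp.linearCombination ℂ fun w => Finsupp.single w (wordWeight X i w)

/-- The action of the `i`-th raising operator on a word, which the commutation relation with the
lowering operators determines letter by letter. -/
def raiseWord (i : Fin n) : List (Fin n) → (List (Fin n) →₀ ℂ)
  | [] => 0
  | j :: w => (if i = j then Finsupp.single w (wordWeight X i w) else 0) + wordF j (raiseWord i w)

/-- The `i`-th raising operator on the span of the words. -/
def wordE (i : Fin n) : Module.End ℂ (List (Fin n) →₀ ℂ) :=
  Finsupp.linearCombination ℂ (raiseWord X i)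

lemma wordF_single (j : Fin n) (w : List (Fin n)) (t : ℂ) :
    wordF j (Finsupp.single w t) = Finsupp.single (j :: w) t := by
  simp [wordF]

lemma wordH_single (i : Fin n) (w : List (Fin n)) (t : ℂ) :
    wordH X i (Finsupp.single w t) = wordWeight X i w • Finsupp.single w t := by
  simp [wordH, mul_comm]

lemma wordE_single (i : Fin n) (w : List (Fin n)) (t : ℂ) :
    wordE X i (Finsupp.single w t) = t • raiseWord X i w := by
  simp [wordE]

lemma wordOp_ext {S T : Module.End ℂ (List (Fin n) →₀ ℂ)}
    (h : ∀ w, S (Finsupp.single w 1) = T (Finsupp.single w 1)) : S = T :=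
  Finsupp.lhom_ext' fun w => LinearMap.ext_ring (h w)

lemma wordH_wordF (i j : Fin n) : wordH X i * wordF j = wordF j * wordH X i - X i j • wordF j := by
  refine wordOp_ext fun w => ?_
  simp [wordF_single, wordH_single, wordWeight]

lemma wordH_wordH (i j : Fin n) : wordH X i * wordH X j = wordH X j * wordH X i := by
  refine wordOp_ext fun w => ?_
  simp [wordH_single, mul_comm]

lemma wordE_wordF (i j : Fin n) :
    wordE X i * wordF j = wordF j * wordE X i + if i = j then wordH X i else 0 := by
  refine wordOp_ext fun w => ?_
  rw [Module.End.mul_apply, LinearMap.add_apply, Module.End.mul_apply, wordF_single, wordE_single,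
    wordE_single, raiseWord]
  split_ifs <;> simp [wordH_single, add_comm]

lemma wordH_wordE (i j : Fin n) :
    wordH X i * wordE X j = wordE X j * wordH X i + X i j • wordE X j := by
  refine wordOp_ext fun w => ?_
  induction w with
  | nil => simp [wordE_single, wordH_single, raiseWord]
  | cons k w ih =>
    -- move the lowering operator to the left on both sides
    rw [← wordF_single]
    set v : List (Fin n) →₀ ℂ := Finsupp.single w 1
    have hF : ∀ u, wordH X i (wordF k u) = wordF k (wordH X i u) - X i k • wordF k u :=
      LinearMap.congr_fun (wordH_wordF X i k)
    have hE : ∀ u, wordE X j (wordF k u) =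
        wordF k (wordE X j u) + (if j = k then wordH X j else 0) u :=
      LinearMap.congr_fun (wordE_wordF X j k)
    have hH : wordH X i (wordH X j v) = wordH X j (wordH X i v) :=
      LinearMap.congr_fun (wordH_wordH X i j) v
    simp only [Module.End.mul_apply, LinearMap.add_apply, LinearMap.smul_apply] at ih ⊢
    rw [hE, map_add, hF, ih, hF, map_sub, map_smul, hE, hE]
    split_ifs with hjk
    · subst hjk
      rw [hH, map_add, map_smul]
      module
    · simp only [LinearMap.zero_apply, map_zero, map_add, map_smul]
      module

end Words

/-! ### The Lie algebra defined by the contragredient relations -/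

section Tilde

open FreeLieAlgebra

variable {n : ℕ} {X : Matrix (Fin n) (Fin n) ℂ}

/-- The projection of the free Lie algebra onto its quotient by the contragredient relations. -/
def freeToTilde (X : Matrix (Fin n) (Fin n) ℂ) : FreeLieAlgebra ℂ (Gen n) →ₗ⁅ℂ⁆ KMTilde X :=
  quotientHom _

lemma freeToTilde_of (x : Gen n) : freeToTilde X (of ℂ x) = KMTilde.gen X x := rfl

lemma freeToTilde_eq_zero {x : FreeLieAlgebra ℂ (Gen n)} (hx : KMRel X x) :
    freeToTilde X x = 0 :=
  quotientHom_eq_zero.2 (LieSubmodule.subset_lieSpan hx)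

lemma isChevalley_tilde (X : Matrix (Fin n) (Fin n) ℂ) :
    IsChevalley X (fun i => KMTilde.gen X (Gen.e i)) (fun i => KMTilde.gen X (Gen.f i))
      (fun i => KMTilde.gen X (Gen.h i)) where
  e_f i j := by
    simp only [← freeToTilde_of, ← LieHom.map_lie]
    split_ifs with hij
    · subst hij
      rw [← sub_eq_zero, ← map_sub]
      exact freeToTilde_eq_zero (.ef_same i)
    · exact freeToTilde_eq_zero (.ef_ne i j hij)
  h_h i j := by
    simp only [← freeToTilde_of, ← LieHom.map_lie]
    exact freeToTilde_eq_zero (.hh i j)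
  h_e i j := by
    simp only [← freeToTilde_of, ← LieHom.map_lie, ← map_smul]
    rw [← sub_eq_zero, ← map_sub]
    exact freeToTilde_eq_zero (.he i j)
  h_f i j := by
    simp only [← freeToTilde_of, ← LieHom.map_lie, ← map_smul]
    rw [← sub_eq_zero, sub_neg_eq_add, ← map_add]
    exact freeToTilde_eq_zero (.hf i j)
  generates := by
    set S := LieSubalgebra.lieSpan ℂ (KMTilde X) _
    have hS : ∀ x, KMTilde.gen X x ∈ S := by
      rintro (i | i | i)
      · exact LieSubalgebra.subset_lieSpan (Or.inl (Or.inl ⟨i, rfl⟩))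
      · exact LieSubalgebra.subset_lieSpan (Or.inl (Or.inr ⟨i, rfl⟩))
      · exact LieSubalgebra.subset_lieSpan (Or.inr ⟨i, rfl⟩)
    have : freeToTilde X = S.incl.comp (lift ℂ fun x => ⟨KMTilde.gen X x, hS x⟩) :=
      FreeLieAlgebra.hom_ext fun x => by simp [freeToTilde_of, lift_of_apply]
    refine eq_top_iff.2 fun y _ => ?_
    obtain ⟨y, rfl⟩ := quotientHom_surjective _ y
    change freeToTilde X y ∈ S
    rw [this]
    exact SetLike.coe_mem _

section Hom

variable {M : Type*} [LieRing M] [LieAlgebra ℂ M] {e f h : Fin n → M}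

/-- The universal property of the contragredient relations: elements satisfying them, whether or
not they generate, receive a homomorphism from `KMTilde X`. -/
lemma exists_tilde_hom (e_f : ∀ i j, ⁅e i, f j⁆ = if i = j then h i else 0)
    (h_h : ∀ i j, ⁅h i, h j⁆ = 0) (h_e : ∀ i j, ⁅h i, e j⁆ = X i j • e j)
    (h_f : ∀ i j, ⁅h i, f j⁆ = -(X i j • f j)) :
    ∃ p : KMTilde X →ₗ⁅ℂ⁆ M, (∀ i, p (KMTilde.gen X (Gen.e i)) = e i) ∧
      (∀ i, p (KMTilde.gen X (Gen.f i)) = f i) ∧ ∀ i, p (KMTilde.gen X (Gen.h i)) = h i := by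
  let g : Gen n → M := fun x => match x with
    | .e i => e i
    | .f i => f i
    | .h i => h i
  let q : FreeLieAlgebra ℂ (Gen n) →ₗ⁅ℂ⁆ M := lift ℂ g
  have hq : ∀ x, q (of ℂ x) = g x := lift_of_apply g
  have hle : LieSubmodule.lieSpan ℂ (FreeLieAlgebra ℂ (Gen n)) {x | KMRel X x} ≤ q.ker := by
    refine LieSubmodule.lieSpan_le.2 fun x hx => LieHom.mem_ker.2 ?_
    induction hx with
    | ef_same i => simp [hq, g, e_f]
    | ef_ne i j hij => simp [hq, g, e_f, hij]
    | hh i j => simp [hq, g, h_h]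
    | he i j => simp [hq, g, h_e]
    | hf i j => simp [hq, g, h_f]
  exact ⟨quotientLift _ q hle, fun i => hq _, fun i => hq _, fun i => hq _⟩

/-- The epimorphism from `KMTilde X` onto a Lie algebra with generators satisfying the
contragredient relations. -/
def IsChevalley.tildeHom (c : IsChevalley X e f h) : KMTilde X →ₗ⁅ℂ⁆ M :=
  (exists_tilde_hom c.e_f c.h_h c.h_e c.h_f).choose

namespace IsChevalley

variable (c : IsChevalley X e f h)

lemma tildeHom_e (i : Fin n) : c.tildeHom (KMTilde.gen X (Gen.e i)) = e i :=
  (exists_tilde_hom c.e_f c.h_h c.h_e c.h_f).choose_spec.1 i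

lemma tildeHom_f (i : Fin n) : c.tildeHom (KMTilde.gen X (Gen.f i)) = f i :=
  (exists_tilde_hom c.e_f c.h_h c.h_e c.h_f).choose_spec.2.1 i

lemma tildeHom_h (i : Fin n) : c.tildeHom (KMTilde.gen X (Gen.h i)) = h i :=
  (exists_tilde_hom c.e_f c.h_h c.h_e c.h_f).choose_spec.2.2 i

lemma tildeHom_surjective : Function.Surjective c.tildeHom :=
  c.surjective_of_mem_range _ (fun i => ⟨_, c.tildeHom_e i⟩) (fun i => ⟨_, c.tildeHom_f i⟩)
    fun i => ⟨_, c.tildeHom_h i⟩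

lemma eq_tildeHom {p : KMTilde X →ₗ⁅ℂ⁆ M} (he : ∀ i, p (KMTilde.gen X (Gen.e i)) = e i)
    (hf : ∀ i, p (KMTilde.gen X (Gen.f i)) = f i) (hh : ∀ i, p (KMTilde.gen X (Gen.h i)) = h i) :
    p = c.tildeHom :=
  (isChevalley_tilde X).hom_ext (fun i => (he i).trans (c.tildeHom_e i).symm)
    (fun i => (hf i).trans (c.tildeHom_f i).symm) fun i => (hh i).trans (c.tildeHom_h i).symm

end IsChevalley

end Hom

attribute [local instance] LieRing.ofAssociativeRing in
/-- The coroots of `KMTilde X` are linearly independent: a relation between them, applied to the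
empty word and to the words of length one, gives a relation between the rows of `X`. -/
lemma linearIndependent_tilde (hX : IsUnit X) :
    LinearIndependent ℂ fun i => KMTilde.gen X (Gen.h i) := by
  obtain ⟨p, -, -, hp⟩ := exists_tilde_hom (X := X) (e := wordE X) (f := wordF) (h := wordH X)
    (fun i j => by rw [Ring.lie_def, wordE_wordF]; abel)
    (fun i j => by rw [Ring.lie_def, wordH_wordH, sub_self])
    (fun i j => by rw [Ring.lie_def, wordH_wordE]; abel)
    (fun i j => by rw [Ring.lie_def, wordH_wordF]; abel)
  refine LinearIndependent.of_comp (p : KMTilde X →ₗ[ℂ] Module.End ℂ (List (Fin n) →₀ ℂ)) ?_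
  have hp' : (p : KMTilde X →ₗ[ℂ] Module.End ℂ (List (Fin n) →₀ ℂ)) ∘
      (fun i => KMTilde.gen X (Gen.h i)) = wordH X := funext hp
  rw [hp', Fintype.linearIndependent_iff]
  intro a ha
  have hw : ∀ w, ∑ i, a i * wordWeight X i w = 0 := fun w => by
    have := congrArg (fun S : Module.End ℂ (List (Fin n) →₀ ℂ) => S (Finsupp.single w 1) w) ha
    simpa [LinearMap.sum_apply, wordH_single, Finsupp.finsetSum_apply] using this
  have hv : Matrix.vecMul a X = 0 := funext fun j => by
    have h0 := hw []
    have h1 := hw [j]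
    simp only [wordWeight, mul_sub, Finset.sum_sub_distrib] at h0 h1
    rw [h0, zero_sub, neg_eq_zero] at h1
    exact h1
  have := Matrix.vecMul_injective_of_isUnit hX (hv.trans (Matrix.zero_vecMul X).symm)
  exact fun i => congrFun this i

/-! ### The radical -/

lemma mem_rootComponent_of_hasRootDegree {α : Fin n → ℤ} {x : KMTilde X}
    (hx : HasRootDegree X α x) : x ∈ rootComponent X α :=
  Submodule.subset_span hx

lemma rootComponent_le_eigenspace (hX : IsUnit X) (d : Fin n → ℂ) (α : Fin n → ℤ) :
    rootComponent X α ≤ (LieAlgebra.ad ℂ (KMTilde X)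
      (weightElement X (fun i => KMTilde.gen X (Gen.h i)) d)).eigenspace
        (∑ i, (α i : ℂ) * d i) := by
  refine Submodule.span_le.2 fun x hx => ?_
  rw [SetLike.mem_coe, Module.End.mem_eigenspace_iff, LieAlgebra.ad_apply]
  have c := isChevalley_tilde X
  induction hx with
  | e i => simp [c.weightElement_e hX, Pi.single_apply]
  | f i => simp [c.weightElement_f hX, Pi.single_apply]
  | h i => simp [c.weightElement_h]
  | lie α β x y _ _ hx hy =>
    rw [lie_lie_eq_smul hx hy, ← Finset.sum_add_distrib]
    simp [add_mul]

lemma iSup_rootComponent (X : Matrix (Fin n) (Fin n) ℂ) : ⨆ α, rootComponent X α = ⊤ := by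
  have c := isChevalley_tilde X
  have key : ∀ {α : Fin n → ℤ} {y : KMTilde X}, HasRootDegree X α y →
      ∀ x ∈ ⨆ α, rootComponent X α, ⁅y, x⁆ ∈ ⨆ α, rootComponent X α := by
    intro α y hy x hx
    refine (iSup_le (a := (⨆ α, rootComponent X α).comap
      (LieAlgebra.ad ℂ (KMTilde X) y)) fun β z hz => ?_) hx
    exact lie_mem_of_mem_span hz fun z hz => Submodule.mem_iSup_of_mem (α + β)
      (mem_rootComponent_of_hasRootDegree (.lie α β y z hy hz))
  have mem : ∀ {α : Fin n → ℤ} {y : KMTilde X}, HasRootDegree X α y →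
      y ∈ ⨆ α, rootComponent X α := fun {α y} hy =>
    Submodule.mem_iSup_of_mem α (mem_rootComponent_of_hasRootDegree hy)
  exact c.eq_top_of_stable (fun i => key (.e i)) (fun i => key (.f i)) (fun i => key (.h i))
    (fun i => mem (.e i)) (fun i => mem (.f i)) fun i => mem (.h i)

/-- Since `X` is invertible, the gradation by the root lattice is given by the eigenspaces of an
inner derivation, so that every ideal is graded. -/
lemma isRootGraded (hX : IsUnit X) (I : LieIdeal ℂ (KMTilde X)) : IsRootGraded X I := by
  obtain ⟨d, hd⟩ := exists_injective_weights n
  exact eq_iSup_inf_of_stable hd (rootComponent_le_eigenspace hX d) (iSup_rootComponent X) _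
    fun x hx => I.lie_mem hx

lemma kmRadical_inf_corootSpan (hX : IsUnit X) :
    (kmRadical X).toSubmodule ⊓ corootSpan X = ⊥ := by
  have c := isChevalley_tilde X
  have h0 : component X (fun i => KMTilde.gen X (Gen.h i)) 0 = corootSpan X := c.component_zero hX
  -- An ideal in the family has no part of degree zero, hence neither has their sum.
  have hle : (kmRadical X).toSubmodule ≤
      ⨆ (k : ℤ) (_ : k ≠ 0), component X (fun i => KMTilde.gen X (Gen.h i)) k := by
    rw [kmRadical, LieSubmodule.sSup_toSubmodule_eq_iSup]
    refine iSup₂_le fun I hI => ?_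
    rw [c.eq_iSup_inf_component hX I]
    refine iSup_le fun k => ?_
    by_cases hk : k = 0
    · subst hk
      rw [h0, hI.2]
      exact bot_le
    · exact inf_le_right.trans (le_iSup₂_of_le k hk le_rfl)
  rw [← h0, ← disjoint_iff]
  exact (IsChevalley.iSupIndep_component 0).symm.mono_left hle

lemma le_kmRadical (hX : IsUnit X) {I : LieIdeal ℂ (KMTilde X)}
    (hI : I.toSubmodule ⊓ corootSpan X = ⊥) : I ≤ kmRadical X :=
  le_sSup ⟨isRootGraded hX I, hI⟩

end Tilde

/-! ### Kernels, ideals and transitivity -/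

section Reduced

variable {n : ℕ} {X : Matrix (Fin n) (Fin n) ℂ} {M N : Type*} [LieRing M] [LieAlgebra ℂ M]
  [LieRing N] [LieAlgebra ℂ N] {e f h : Fin n → M} {e' f' h' : Fin n → N}

namespace IsChevalley

lemma map (c : IsChevalley X e f h) {p : M →ₗ⁅ℂ⁆ N} (hp : Function.Surjective p) :
    IsChevalley X (p ∘ e) (p ∘ f) (p ∘ h) where
  e_f i j := by
    simp only [Function.comp_apply, ← LieHom.map_lie, c.e_f]
    split_ifs <;> simp
  h_h i j := by simp only [Function.comp_apply, ← LieHom.map_lie, c.h_h, map_zero]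
  h_e i j := by simp only [Function.comp_apply, ← LieHom.map_lie, c.h_e, map_smul]
  h_f i j := by simp only [Function.comp_apply, ← LieHom.map_lie, c.h_f, map_neg, map_smul]
  generates := by
    set S := LieSubalgebra.lieSpan ℂ N _
    have : LieSubalgebra.lieSpan ℂ M (Set.range e ∪ Set.range f ∪ Set.range h) ≤ S.comap p := by
      rw [LieSubalgebra.lieSpan_le]
      rintro x ((⟨i, rfl⟩ | ⟨i, rfl⟩) | ⟨i, rfl⟩)
      · exact LieSubalgebra.subset_lieSpan (Or.inl (Or.inl ⟨i, rfl⟩))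
      · exact LieSubalgebra.subset_lieSpan (Or.inl (Or.inr ⟨i, rfl⟩))
      · exact LieSubalgebra.subset_lieSpan (Or.inr ⟨i, rfl⟩)
    rw [c.generates] at this
    refine eq_top_iff.2 fun y _ => ?_
    obtain ⟨x, rfl⟩ := hp y
    exact this (LieSubalgebra.mem_top x)

lemma tildeHom_map (c : IsChevalley X e f h) {p : M →ₗ⁅ℂ⁆ N} (hp : Function.Surjective p) :
    (c.map hp).tildeHom = p.comp c.tildeHom :=
  ((c.map hp).eq_tildeHom (fun i => congrArg p (c.tildeHom_e i))
    (fun i => congrArg p (c.tildeHom_f i)) fun i => congrArg p (c.tildeHom_h i)).symm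

lemma exists_hom_of_ker_le (c : IsChevalley X e f h) (c' : IsChevalley X e' f' h')
    (hle : c.tildeHom.ker ≤ c'.tildeHom.ker) :
    ∃ p : M →ₗ⁅ℂ⁆ N, Function.Surjective p ∧
      (∀ i, p (e i) = e' i) ∧ (∀ i, p (f i) = f' i) ∧ ∀ i, p (h i) = h' i := by
  let E := quotientEquiv c.tildeHom_surjective rfl
  let p : M →ₗ⁅ℂ⁆ N := (quotientLift _ c'.tildeHom hle).comp E.symm.toLieHom
  have hp : ∀ x, p (c.tildeHom x) = c'.tildeHom x := fun x => by
    have : E.symm (c.tildeHom x) = quotientHom _ x := E.symm_apply_apply (quotientHom _ x)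
    change quotientLift _ c'.tildeHom hle (E.symm (c.tildeHom x)) = _
    rw [this]
    rfl
  refine ⟨p, fun y => ?_, fun i => ?_, fun i => ?_, fun i => ?_⟩
  · obtain ⟨x, rfl⟩ := c'.tildeHom_surjective y
    exact ⟨_, hp x⟩
  · rw [← c.tildeHom_e, hp, c'.tildeHom_e]
  · rw [← c.tildeHom_f, hp, c'.tildeHom_f]
  · rw [← c.tildeHom_h, hp, c'.tildeHom_h]

lemma ker_tildeHom_le_of_hom (c : IsChevalley X e f h) (c' : IsChevalley X e' f' h')
    (p : M →ₗ⁅ℂ⁆ N) (he : ∀ i, p (e i) = e' i) (hf : ∀ i, p (f i) = f' i)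
    (hh : ∀ i, p (h i) = h' i) : c.tildeHom.ker ≤ c'.tildeHom.ker := by
  have : p.comp c.tildeHom = c'.tildeHom := c'.eq_tildeHom
    (fun i => (congrArg p (c.tildeHom_e i)).trans (he i))
    (fun i => (congrArg p (c.tildeHom_f i)).trans (hf i))
    fun i => (congrArg p (c.tildeHom_h i)).trans (hh i)
  intro x hx
  rw [LieHom.mem_ker] at hx ⊢
  rw [← this, LieHom.comp_apply, hx, map_zero]

lemma map_corootSpan (c : IsChevalley X e f h) :
    (corootSpan X).map (c.tildeHom : KMTilde X →ₗ[ℂ] M) = Submodule.span ℂ (Set.range h) := by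
  rw [corootSpan, Submodule.map_span, ← Set.range_comp]
  exact congrArg (fun v => Submodule.span ℂ (Set.range v)) (funext c.tildeHom_h)

/-- If the coroots stay independent, the kernel of the projection from `KMTilde X` contains no
combination of coroots. -/
lemma ker_inf_corootSpan (c : IsChevalley X e f h) (hh : LinearIndependent ℂ h) :
    c.tildeHom.ker.toSubmodule ⊓ corootSpan X = ⊥ := by
  rw [eq_bot_iff]
  rintro x ⟨hx, hx'⟩
  obtain ⟨a, rfl⟩ := (Submodule.mem_span_range_iff_exists_fun ℂ).1 hx'
  have h0 := LieHom.mem_ker.1 hx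
  simp only [map_sum, map_smul, c.tildeHom_h] at h0
  have := Fintype.linearIndependent_iff.1 hh a h0
  simp [this]

lemma ker_le_kmRadical (c : IsChevalley X e f h) (hX : IsUnit X) (hh : LinearIndependent ℂ h) :
    c.tildeHom.ker ≤ kmRadical X :=
  le_kmRadical hX (c.ker_inf_corootSpan hh)

lemma linearIndependent_of_ker_le (c : IsChevalley X e f h) (hX : IsUnit X)
    (hk : c.tildeHom.ker ≤ kmRadical X) : LinearIndependent ℂ h := by
  rw [Fintype.linearIndependent_iff]
  intro a ha
  refine Fintype.linearIndependent_iff.1 (linearIndependent_tilde hX) a ?_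
  have h0 : c.tildeHom (∑ i, a i • KMTilde.gen X (Gen.h i)) = 0 := by
    simpa only [map_sum, map_smul, c.tildeHom_h] using ha
  have hmem : ∑ i, a i • KMTilde.gen X (Gen.h i) ∈
      (kmRadical X).toSubmodule ⊓ corootSpan X :=
    ⟨hk (LieHom.mem_ker.2 h0), (Submodule.mem_span_range_iff_exists_fun ℂ).2 ⟨a, rfl⟩⟩
  rwa [kmRadical_inf_corootSpan hX, Submodule.mem_bot] at hmem

lemma linearIndependent_e (c : IsChevalley X e f h) (hh : LinearIndependent ℂ h) :
    LinearIndependent ℂ e := by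
  rw [Fintype.linearIndependent_iff]
  intro a ha j
  have := congrArg (fun x => ⁅x, f j⁆) ha
  simp only [sum_lie, smul_lie, c.e_f, zero_lie, smul_ite, smul_zero, Finset.sum_ite_eq',
    Finset.mem_univ, if_true] at this
  exact (smul_eq_zero.1 this).resolve_right (hh.ne_zero j)

lemma linearIndependent_f (c : IsChevalley X e f h) (hh : LinearIndependent ℂ h) :
    LinearIndependent ℂ f := by
  rw [Fintype.linearIndependent_iff]
  intro a ha j
  have := congrArg (fun x => ⁅e j, x⁆) ha
  simp only [lie_sum, lie_smul, c.e_f, lie_zero, smul_ite, smul_zero, Finset.sum_ite_eq,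
    Finset.mem_univ, if_true] at this
  exact (smul_eq_zero.1 this).resolve_right (hh.ne_zero j)

end IsChevalley

/-- No non-zero ideal meets the span of the coroots `h i` trivially. -/
def IsReduced (h : Fin n → M) : Prop :=
  ∀ I : LieIdeal ℂ M, I.toSubmodule ⊓ Submodule.span ℂ (Set.range h) = ⊥ → I = ⊥

namespace IsChevalley

lemma isReduced_of_ker_eq (c : IsChevalley X e f h) (hX : IsUnit X)
    (hk : c.tildeHom.ker = kmRadical X) : IsReduced h := by
  intro I hI
  have hJ : I.comap c.tildeHom ≤ kmRadical X := by
    refine le_kmRadical hX ?_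
    rw [eq_bot_iff]
    rintro x ⟨hx, hx'⟩
    have h0 : c.tildeHom x ∈ I.toSubmodule ⊓ Submodule.span ℂ (Set.range h) :=
      ⟨LieIdeal.mem_comap.1 hx, c.map_corootSpan ▸ Submodule.mem_map_of_mem hx'⟩
    rw [hI, Submodule.mem_bot, ← LieHom.mem_ker, hk] at h0
    rw [← kmRadical_inf_corootSpan hX]
    exact ⟨h0, hx'⟩
  rw [eq_bot_iff]
  intro y hy
  obtain ⟨x, rfl⟩ := c.tildeHom_surjective y
  have : x ∈ c.tildeHom.ker := hk ▸ hJ (LieIdeal.mem_comap.2 hy)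
  exact (LieSubmodule.mem_bot _).2 (LieHom.mem_ker.1 this)

lemma ker_eq_of_isReduced (c : IsChevalley X e f h) (hX : IsUnit X) (hh : LinearIndependent ℂ h)
    (hr : IsReduced h) : c.tildeHom.ker = kmRadical X := by
  refine le_antisymm (c.ker_le_kmRadical hX hh) ?_
  have := hr ((kmRadical X).map c.tildeHom) ?_
  · intro x hx
    rw [LieHom.mem_ker, ← LieSubmodule.mem_bot (R := ℂ) (L := M), ← this]
    exact LieIdeal.mem_map hx
  rw [eq_bot_iff]
  rintro y ⟨hy, hy'⟩
  obtain ⟨x, hx⟩ := LieIdeal.mem_map_of_surjective c.tildeHom_surjective hy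
  rw [← c.map_corootSpan] at hy'
  obtain ⟨z, hz, hzy⟩ := hy'
  -- `x` lies in the radical and differs from `z` by an element of the kernel
  have hxz : z - x.1 ∈ kmRadical X := c.ker_le_kmRadical hX hh (LieHom.mem_ker.2 (by
    rw [map_sub, hx, sub_eq_zero]; exact hzy))
  have hz' : z ∈ (kmRadical X).toSubmodule ⊓ corootSpan X :=
    ⟨by simpa using add_mem hxz x.2, hz⟩
  rw [kmRadical_inf_corootSpan hX, Submodule.mem_bot] at hz'
  rw [Submodule.mem_bot, ← hzy, hz', map_zero]

/-- In a reduced algebra an element of degree at least two that commutes with all `f i` vanishes: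
the ideal it generates is spanned by brackets with the `e i` and `h i`, hence lives in positive
degrees. -/
lemma eq_zero_of_lie_f_eq_zero (c : IsChevalley X e f h) (hX : IsUnit X) (hr : IsReduced h)
    {k : ℤ} (hk : 2 ≤ k) {x : M} (hx : x ∈ component X h k) (hxf : ∀ i, ⁅x, f i⁆ = 0) : x = 0 := by
  let F : Set (Submodule ℂ M) :=
    {S | x ∈ S ∧ (∀ i, ∀ y ∈ S, ⁅e i, y⁆ ∈ S) ∧ ∀ i, ∀ y ∈ S, ⁅h i, y⁆ ∈ S}
  let S : Submodule ℂ M := sInf F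
  have hle : ∀ {T}, T ∈ F → ∀ y ∈ S, y ∈ T := fun hT y hy => (sInf_le hT : S ≤ _) hy
  have hxS : x ∈ S := Submodule.mem_sInf.2 fun T hT => hT.1
  have he : ∀ i, ∀ y ∈ S, ⁅e i, y⁆ ∈ S := fun i y hy =>
    Submodule.mem_sInf.2 fun T hT => hT.2.1 i y (hle hT y hy)
  have hh : ∀ i, ∀ y ∈ S, ⁅h i, y⁆ ∈ S := fun i y hy =>
    Submodule.mem_sInf.2 fun T hT => hT.2.2 i y (hle hT y hy)
  have hf : ∀ i, ∀ y ∈ S, ⁅f i, y⁆ ∈ S := by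
    let S' : Submodule ℂ M := S ⊓ ⨅ i, S.comap (LieAlgebra.ad ℂ M (f i))
    have mem : ∀ y, y ∈ S' ↔ y ∈ S ∧ ∀ i, ⁅f i, y⁆ ∈ S := fun y => by
      simp [S', Submodule.mem_inf, Submodule.mem_iInf]
    have hS' : S' ∈ F := by
      refine ⟨(mem x).2 ⟨hxS, fun i => ?_⟩, fun j y hy => ?_, fun j y hy => ?_⟩
      · rw [← lie_skew, hxf]
        simp
      · obtain ⟨hy, hy'⟩ := (mem y).1 hy
        refine (mem _).2 ⟨he j y hy, fun i => ?_⟩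
        rw [leibniz_lie, c.swap.e_f]
        refine add_mem ?_ (he j _ (hy' i))
        split_ifs
        · rw [Pi.neg_apply, neg_lie]
          exact neg_mem (hh i y hy)
        · simp
      · obtain ⟨hy, hy'⟩ := (mem y).1 hy
        refine (mem _).2 ⟨hh j y hy, fun i => ?_⟩
        rw [leibniz_lie, show ⁅f i, h j⁆ = X j i • f i by rw [← lie_skew, c.h_f, neg_neg], smul_lie]
        exact add_mem (S.smul_mem _ (hy' i)) (hh j _ (hy' i))
    exact fun i y hy => ((mem y).1 (hle hS' y hy)).2 i
  let P : Submodule ℂ M := ⨆ (m : ℤ) (_ : 2 ≤ m), component X h m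
  have hP : P ∈ F := by
    have key : ∀ (a : M) (d : ℤ), 0 ≤ d → a ∈ component X h d → ∀ y ∈ P, ⁅a, y⁆ ∈ P := by
      intro a d hd ha y hy
      refine (iSup₂_le (a := P.comap (LieAlgebra.ad ℂ M a)) fun m hm z hz => ?_) hy
      have hdm : 2 ≤ d + m := by omega
      exact (le_iSup₂_of_le (f := fun (m : ℤ) (_ : 2 ≤ m) => component X h m) (d + m) hdm le_rfl)
        (lie_mem_component ha hz)
    refine ⟨(le_iSup₂_of_le (f := fun (m : ℤ) (_ : 2 ≤ m) => component X h m) k hk le_rfl) hx,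
      fun i => key _ 1 zero_le_one (c.e_mem_component hX i),
      fun i => key _ 0 le_rfl (c.h_mem_component i)⟩
  let I : LieIdeal ℂ M :=
    { S with lie_mem := fun {y z} hz => c.lie_mem_of_stable he hf hh y z hz }
  have hI : I = ⊥ := by
    refine hr I ?_
    rw [← c.component_zero hX, ← disjoint_iff]
    refine (iSupIndep_component 0).symm.mono_left ?_
    intro y hy
    refine (iSup₂_le fun m hm => ?_ : P ≤ _) (hle hP y hy)
    exact le_iSup₂_of_le m (by omega) le_rfl
  have : x ∈ I := hxS
  rwa [hI, LieSubmodule.mem_bot] at this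

lemma eq_zero_of_lie_e_eq_zero (c : IsChevalley X e f h) (hX : IsUnit X) (hr : IsReduced h)
    {k : ℤ} (hk : k ≤ -2) {x : M} (hx : x ∈ component X h k) (hxe : ∀ i, ⁅x, e i⁆ = 0) :
    x = 0 := by
  have hr' : IsReduced (-h) := fun I hI => hr I (by rwa [span_range_neg] at hI)
  exact c.swap.eq_zero_of_lie_f_eq_zero hX hr' (k := -k) (by omega)
    (by rwa [component_neg, neg_neg]) hxe

/-- An ideal without part of degree zero vanishes in degree `k ≥ 1`, by induction on `k`, if
elements of degree at least two that commute with all `f i` vanish. -/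
lemma ideal_eq_zero_of_transitive (c : IsChevalley X e f h) (hX : IsUnit X)
    (hh : LinearIndependent ℂ h)
    (ht : ∀ k : ℤ, 2 ≤ k → ∀ x ∈ component X h k, (∀ i, ⁅x, f i⁆ = 0) → x = 0)
    {I : LieIdeal ℂ M} (hI : I.toSubmodule ⊓ Submodule.span ℂ (Set.range h) = ⊥) (k : ℕ) :
    ∀ x ∈ I, x ∈ component X h k → x = 0 := by
  rw [← c.component_zero hX] at hI
  have lie_mem : ∀ (k : ℕ), ∀ x ∈ I, x ∈ component X h ((k + 1 : ℕ) : ℤ) → ∀ i,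
      ⁅x, f i⁆ ∈ I ∧ ⁅x, f i⁆ ∈ component X h (k : ℤ) := fun k x hx hx' i => by
    refine ⟨lie_mem_left ℂ M I x (f i) hx, ?_⟩
    have := lie_mem_component hx' (c.f_mem_component hX i)
    rwa [show ((k + 1 : ℕ) : ℤ) + -1 = k by push_cast; ring] at this
  induction k with
  | zero =>
    intro x hx hx'
    have : x ∈ I.toSubmodule ⊓ component X h 0 := ⟨hx, hx'⟩
    rwa [hI, Submodule.mem_bot] at this
  | succ k ih =>
    intro x hx hx'
    have hxf : ∀ i, ⁅x, f i⁆ = 0 := fun i =>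
      ih _ (lie_mem k x hx hx' i).1 (lie_mem k x hx hx' i).2
    rcases Nat.eq_zero_or_pos k with rfl | hk
    · -- in degree one `x` is a combination of the `e i`, which the `f i` detect
      rw [show ((0 + 1 : ℕ) : ℤ) = 1 by norm_num, c.component_one hX] at hx'
      obtain ⟨a, rfl⟩ := (Submodule.mem_span_range_iff_exists_fun ℂ).1 hx'
      refine Finset.sum_eq_zero fun j _ => ?_
      have := hxf j
      simp only [sum_lie, smul_lie, c.e_f, smul_ite, smul_zero, Finset.sum_ite_eq',
        Finset.mem_univ, if_true] at this
      rw [(smul_eq_zero.1 this).resolve_right (hh.ne_zero j), zero_smul]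
    · exact ht _ (by push_cast; omega) x hx' hxf

lemma isReduced_of_transitive (c : IsChevalley X e f h) (hX : IsUnit X)
    (hh : LinearIndependent ℂ h)
    (ht : ∀ k : ℤ, 2 ≤ k → ∀ x ∈ component X h k, (∀ i, ⁅x, f i⁆ = 0) → x = 0)
    (ht' : ∀ k : ℤ, k ≤ -2 → ∀ x ∈ component X h k, (∀ i, ⁅x, e i⁆ = 0) → x = 0) :
    IsReduced h := by
  intro I hI
  have hneg := c.swap.ideal_eq_zero_of_transitive hX
    (I := I) (by rw [show (-h) = fun i => (-1 : ℂ) • h i from funext fun i => by simp]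
                 exact hh.units_smul fun _ => -1)
    (fun k hk x hx => ht' (-k) (by omega) x (by rwa [← component_neg]))
    (by rwa [span_range_neg])
  have hpos := c.ideal_eq_zero_of_transitive hX hh ht hI
  rw [← LieSubmodule.toSubmodule_eq_bot, eq_bot_iff, c.eq_iSup_inf_component hX I]
  refine iSup_le fun k x hx => ?_
  rcases le_total 0 k with hk | hk
  · lift k to ℕ using hk
    exact hpos k x hx.1 hx.2
  · obtain ⟨m, rfl⟩ : ∃ m : ℕ, k = -m := ⟨k.natAbs, by omega⟩
    exact hneg m x hx.1 (by rw [component_neg]; exact hx.2)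

end IsChevalley

end Reduced

/-! ### Local parts and minimality -/

section Local

lemma le_localPart {G : Type u} [LieRing G] [LieAlgebra ℂ G] (𝒢 : ℤ → Submodule ℂ G) {i : ℤ}
    (hi : |i| ≤ 1) : 𝒢 i ≤ localPart 𝒢 := by
  obtain rfl | rfl | rfl : i = -1 ∨ i = 0 ∨ i = 1 := by
    rw [abs_le] at hi
    omega
  · exact le_sup_of_le_left le_sup_left
  · exact le_sup_of_le_left le_sup_right
  · exact le_sup_right

variable {G G' : Type u} [LieRing G] [LieAlgebra ℂ G] [LieRing G'] [LieAlgebra ℂ G']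
  {𝒢 : ℤ → Submodule ℂ G} {𝒢' : ℤ → Submodule ℂ G'}

lemma IsLocalIso.symm {ψ : localPart 𝒢' ≃ₗ[ℂ] localPart 𝒢} (hψ : IsLocalIso 𝒢' 𝒢 ψ)
    (h𝒢' : IsGradedLieAlgebra 𝒢') : IsLocalIso 𝒢 𝒢' ψ.symm where
  mem_iff i hi x := by rw [hψ.mem_iff i hi, LinearEquiv.apply_symm_apply]
  map_lie i j hi hj hij x y z hx hy hz := by
    have hx' : (ψ.symm x : G') ∈ 𝒢' i := by rwa [hψ.mem_iff i hi, LinearEquiv.apply_symm_apply]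
    have hy' : (ψ.symm y : G') ∈ 𝒢' j := by rwa [hψ.mem_iff j hj, LinearEquiv.apply_symm_apply]
    let w : localPart 𝒢' :=
      ⟨⁅(ψ.symm x : G'), (ψ.symm y : G')⁆, le_localPart 𝒢' hij (h𝒢'.lie_mem i j _ hx' _ hy')⟩
    have hw : ψ w = z := Subtype.ext <| by
      rw [hψ.map_lie i j hi hj hij _ _ w hx' hy' rfl, hz, LinearEquiv.apply_symm_apply,
        LinearEquiv.apply_symm_apply]
    rw [← hw, LinearEquiv.symm_apply_apply]

end Local

section Graded

variable {n : ℕ} {X : Matrix (Fin n) (Fin n) ℂ} {G : Type u} [LieRing G] [LieAlgebra ℂ G]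
  {𝒢 : ℤ → Submodule ℂ G} {e f h : Fin n → G}

lemma IsGradedLieAlgebra.isChevalley (h𝒢 : IsGradedLieAlgebra 𝒢)
    (hspan : localPart 𝒢 ≤ Submodule.span ℂ (Set.range e ∪ Set.range f ∪ Set.range h))
    (e_f : ∀ i j, ⁅e i, f j⁆ = if i = j then h i else 0) (h_h : ∀ i j, ⁅h i, h j⁆ = 0)
    (h_e : ∀ i j, ⁅h i, e j⁆ = X i j • e j) (h_f : ∀ i j, ⁅h i, f j⁆ = -(X i j • f j)) :
    IsChevalley X e f h where
  e_f := e_f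
  h_h := h_h
  h_e := h_e
  h_f := h_f
  generates := by
    rw [eq_top_iff, ← h𝒢.generates, LieSubalgebra.lieSpan_le]
    exact hspan.trans (LieSubalgebra.submodule_span_le_lieSpan)

lemma localPart_eq_span (hf : 𝒢 (-1) = Submodule.span ℂ (Set.range f))
    (hh : 𝒢 0 = Submodule.span ℂ (Set.range h)) (he : 𝒢 1 = Submodule.span ℂ (Set.range e)) :
    localPart 𝒢 = Submodule.span ℂ (Set.range e ∪ Set.range f ∪ Set.range h) := by
  rw [localPart, hf, hh, he, Submodule.span_union, Submodule.span_union, sup_comm, sup_assoc]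

lemma IsChevalley.localPart_component (c : IsChevalley X e f h) (hX : IsUnit X) :
    localPart (component X h) = Submodule.span ℂ (Set.range e ∪ Set.range f ∪ Set.range h) :=
  localPart_eq_span (c.component_neg_one hX) (c.component_zero hX) (c.component_one hX)

/-- The components of degrees `-1`, `0`, `1` are independent, as eigenspaces. -/
lemma IsChevalley.eq_zero_of_add_eq_zero {x y z : G} (hx : x ∈ component X h (-1))
    (hy : y ∈ component X h 0) (hz : z ∈ component X h 1) (hsum : x + y + z = 0) :
    x = 0 ∧ y = 0 ∧ z = 0 := by
  have key := congrArg (fun v => ⁅weightElement X h 1, v⁆) hsum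
  rw [mem_component] at hx hy hz
  simp only [lie_add, hx, hy, hz, lie_zero] at key
  have key2 := congrArg (fun v => ⁅weightElement X h 1, v⁆) key
  simp only [lie_add, lie_smul, hx, hy, hz, lie_zero] at key2
  have hzx : z = x := by
    have : -x + z = 0 := by simpa using key
    exact (neg_add_eq_zero.1 this).symm
  have hxz : x + z = 0 := by simpa using key2
  have hx0 : x = 0 := by
    rw [hzx, ← two_smul ℂ] at hxz
    exact (smul_eq_zero.1 hxz).resolve_left two_ne_zero
  refine ⟨hx0, ?_, hzx.trans hx0⟩
  rw [hzx, hx0] at hsum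
  simpa using hsum

variable {G' : Type u} [LieRing G'] [LieAlgebra ℂ G'] {e' f' h' : Fin n → G'}

/-- The quotient of `KMTilde X` by the radical is minimal: an isomorphism from the local part of
another graded algebra provides that algebra with generators satisfying the same relations, and the
kernel of the projection from `KMTilde X` onto it is contained in the radical. -/
lemma IsChevalley.isMinimalGraded (c : IsChevalley X e f h) (hX : IsUnit X)
    (hk : c.tildeHom.ker = kmRadical X) : IsMinimalGraded (component X h) := by
  intro G' _ _ 𝒢' h𝒢' ψ hψ
  have hφ := hψ.symm h𝒢'
  let E : Fin n → localPart (component X h) := fun i =>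
    ⟨e i, le_localPart _ (by norm_num) (c.e_mem_component hX i)⟩
  let F : Fin n → localPart (component X h) := fun i =>
    ⟨f i, le_localPart _ (by norm_num) (c.f_mem_component hX i)⟩
  let H : Fin n → localPart (component X h) := fun i =>
    ⟨h i, le_localPart _ (by norm_num) (c.h_mem_component i)⟩
  -- a property of the generators extends to the local part by linearity
  have hind : ∀ S : Submodule ℂ (localPart (component X h)), (∀ i, E i ∈ S) → (∀ i, F i ∈ S) →
      (∀ i, H i ∈ S) → ∀ x, x ∈ S := by
    intro S hE hF hH x
    have hle : localPart (component X h) ≤ S.map (localPart (component X h)).subtype := by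
      conv_lhs => rw [c.localPart_component hX]
      refine Submodule.span_le.2 ?_
      rintro y ((⟨i, rfl⟩ | ⟨i, rfl⟩) | ⟨i, rfl⟩)
      exacts [⟨E i, hE i, rfl⟩, ⟨F i, hF i, rfl⟩, ⟨H i, hH i, rfl⟩]
    obtain ⟨y, hy, hyx⟩ := hle x.2
    rwa [← Subtype.ext hyx]
  let e' : Fin n → G' := fun i => ψ.symm (E i)
  let f' : Fin n → G' := fun i => ψ.symm (F i)
  let h' : Fin n → G' := fun i => ψ.symm (H i)
  have hE := c.e_mem_component hX
  have hF := c.f_mem_component hX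
  have hH := c.h_mem_component
  have hspan : localPart 𝒢' ≤ Submodule.span ℂ (Set.range e' ∪ Set.range f' ∪ Set.range h') := by
    intro x hx
    have := hind ((Submodule.span ℂ (Set.range e' ∪ Set.range f' ∪ Set.range h')).comap
      ((localPart 𝒢').subtype ∘ₗ (ψ.symm : localPart (component X h) →ₗ[ℂ] localPart 𝒢')))
      (fun i => Submodule.subset_span (Or.inl (Or.inl ⟨i, rfl⟩)))
      (fun i => Submodule.subset_span (Or.inl (Or.inr ⟨i, rfl⟩)))
      (fun i => Submodule.subset_span (Or.inr ⟨i, rfl⟩)) (ψ ⟨x, hx⟩)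
    simpa using this
  have c' : IsChevalley X e' f' h' := by
    refine h𝒢'.isChevalley hspan (fun i j => ?_) (fun i j => ?_) (fun i j => ?_) fun i j => ?_
    · have := hφ.map_lie 1 (-1) (by norm_num) (by norm_num) (by norm_num) (E i) (F j)
        (if i = j then H i else 0) (hE i) (hF j) (by
          change _ = ⁅e i, f j⁆
          rw [c.e_f]
          split_ifs <;> rfl)
      rw [← this]
      split_ifs <;> simp [h']
    · have := hφ.map_lie 0 0 (by norm_num) (by norm_num) (by norm_num) (H i) (H j) 0 (hH i) (hH j)
        (c.h_h i j).symm
      rw [← this]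
      simp
    · have := hφ.map_lie 0 1 (by norm_num) (by norm_num) (by norm_num) (H i) (E j) (X i j • E j)
        (hH i) (hE j) (c.h_e i j).symm
      rw [← this]
      simp [e']
    · have := hφ.map_lie 0 (-1) (by norm_num) (by norm_num) (by norm_num) (H i) (F j)
        (-(X i j • F j)) (hH i) (hF j) (c.h_f i j).symm
      rw [← this]
      simp [f']
  have hlin : LinearIndependent ℂ h' := by
    have hh := c.linearIndependent_of_ker_le hX hk.le
    have hHlin : LinearIndependent ℂ H :=
      LinearIndependent.of_comp (localPart (component X h)).subtype hh
    exact hHlin.map' ((localPart 𝒢').subtype ∘ₗ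
      (ψ.symm : localPart (component X h) →ₗ[ℂ] localPart 𝒢'))
      (LinearMap.ker_eq_bot.2 (Subtype.val_injective.comp ψ.symm.injective))
  obtain ⟨p, hp, hpe, hpf, hph⟩ :=
    c'.exists_hom_of_ker_le c ((c'.ker_le_kmRadical hX hlin).trans hk.ge)
  refine ⟨p, hp, fun x => ?_⟩
  have := hind (LinearMap.eqLocus ((p : G' →ₗ[ℂ] G) ∘ₗ (localPart 𝒢').subtype ∘ₗ
    (ψ.symm : localPart (component X h) →ₗ[ℂ] localPart 𝒢')) (localPart (component X h)).subtype)
    hpe hpf hph (ψ x)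
  simpa using this

/-- A homomorphism between algebras with generators that matches the generators restricts to an
isomorphism of local parts, if the coroots are independent in the target. -/
lemma IsChevalley.exists_localIso (c : IsChevalley X e f h) (c' : IsChevalley X e' f' h')
    (hX : IsUnit X) (hh' : LinearIndependent ℂ h')
    {p : G →ₗ⁅ℂ⁆ G'} (he : ∀ i, p (e i) = e' i) (hf : ∀ i, p (f i) = f' i)
    (hh : ∀ i, p (h i) = h' i) (h𝒢 : ∀ i, |i| ≤ 1 → 𝒢 i = component X h i) :
    ∃ ψ : localPart 𝒢 ≃ₗ[ℂ] localPart (component X h'), IsLocalIso 𝒢 (component X h') ψ ∧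
      ∀ x, (ψ x : G') = p x := by
  have hmap : ∀ i, |i| ≤ 1 → (𝒢 i).map (p : G →ₗ[ℂ] G') = component X h' i := by
    intro i hi
    rw [h𝒢 i hi]
    obtain rfl | rfl | rfl : i = -1 ∨ i = 0 ∨ i = 1 := by
      rw [abs_le] at hi
      omega
    · rw [c.component_neg_one hX, c'.component_neg_one hX, Submodule.map_span, ← Set.range_comp]
      exact congrArg (fun v => Submodule.span ℂ (Set.range v)) (funext hf)
    · rw [c.component_zero hX, c'.component_zero hX, Submodule.map_span, ← Set.range_comp]
      exact congrArg (fun v => Submodule.span ℂ (Set.range v)) (funext hh)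
    · rw [c.component_one hX, c'.component_one hX, Submodule.map_span, ← Set.range_comp]
      exact congrArg (fun v => Submodule.span ℂ (Set.range v)) (funext he)
  have hloc : (localPart 𝒢).map (p : G →ₗ[ℂ] G') = localPart (component X h') := by
    rw [localPart, Submodule.map_sup, Submodule.map_sup, hmap _ (by norm_num),
      hmap _ (by norm_num), hmap _ (by norm_num), localPart]
  -- `p` is injective on each span of generators, since it maps them to independent elements
  have hinj1 : ∀ (v : Fin n → G) (v' : Fin n → G'), (∀ i, p (v i) = v' i) →
      LinearIndependent ℂ v' → ∀ x ∈ Submodule.span ℂ (Set.range v), p x = 0 → x = 0 := by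
    intro v v' hv hlin x hx hpx
    obtain ⟨a, rfl⟩ := (Submodule.mem_span_range_iff_exists_fun ℂ).1 hx
    simp only [map_sum, map_smul, hv] at hpx
    simp [Fintype.linearIndependent_iff.1 hlin a hpx]
  have hinj : ∀ x ∈ localPart 𝒢, p x = 0 → x = 0 := by
    intro x hx hpx
    obtain ⟨y, hy, z, hz, rfl⟩ := Submodule.mem_sup.1 hx
    obtain ⟨u, hu, v, hv, rfl⟩ := Submodule.mem_sup.1 hy
    rw [map_add, map_add] at hpx
    obtain ⟨h1, h2, h3⟩ := IsChevalley.eq_zero_of_add_eq_zero (X := X) (h := h')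
      (hmap (-1) (by norm_num) ▸ Submodule.mem_map_of_mem hu)
      (hmap 0 (by norm_num) ▸ Submodule.mem_map_of_mem hv)
      (hmap 1 (by norm_num) ▸ Submodule.mem_map_of_mem hz) hpx
    rw [h𝒢 _ (by norm_num)] at hu hv hz
    rw [c.component_neg_one hX] at hu
    rw [c.component_zero hX] at hv
    rw [c.component_one hX] at hz
    rw [hinj1 f f' hf (c'.linearIndependent_f hh') u hu h1, hinj1 h h' hh hh' v hv h2,
      hinj1 e e' he (c'.linearIndependent_e hh') z hz h3, add_zero, add_zero]
  let r : localPart 𝒢 →ₗ[ℂ] localPart (component X h') :=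
    (p : G →ₗ[ℂ] G').restrict fun x hx => hloc ▸ Submodule.mem_map_of_mem hx
  have hr : Function.Bijective r := by
    refine ⟨(injective_iff_map_eq_zero r).2 fun x hx => Subtype.ext ?_, fun y => ?_⟩
    · exact hinj x x.2 (congrArg Subtype.val hx)
    · obtain ⟨x, hx, hxy⟩ := hloc.ge y.2
      exact ⟨⟨x, hx⟩, Subtype.ext hxy⟩
  refine ⟨LinearEquiv.ofBijective r hr, ⟨fun i hi x => ⟨fun hx => ?_, fun hx => ?_⟩, ?_⟩,
    fun x => rfl⟩
  · rw [← hmap i hi]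
    exact Submodule.mem_map_of_mem hx
  · rw [← hmap i hi] at hx
    obtain ⟨y, hy, hyx⟩ := hx
    have : r ⟨y, le_localPart 𝒢 hi hy⟩ = r x := Subtype.ext hyx
    rw [← hr.1 this]
    exact hy
  · intro i j _ _ _ x y z _ _ hz
    change p z = ⁅p x, p y⁆
    rw [hz, LieHom.map_lie]

end Graded

/-! ### Contragredient Lie algebras -/

section Contragredient

variable {n : ℕ} {X : Matrix (Fin n) (Fin n) ℂ} {G : Type u} [LieRing G] [LieAlgebra ℂ G]

/-- The basis of a component that is spanned by independent generators. -/
def basisOfEqSpan {v : Fin n → G} (hv : LinearIndependent ℂ v) {S : Submodule ℂ G}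
    (hS : S = Submodule.span ℂ (Set.range v)) : Module.Basis (Fin n) ℂ S :=
  (Module.Basis.span hv).map (LinearEquiv.ofEq _ _ hS.symm)

lemma basisOfEqSpan_apply {v : Fin n → G} (hv : LinearIndependent ℂ v) {S : Submodule ℂ G}
    (hS : S = Submodule.span ℂ (Set.range v)) (i : Fin n) : (basisOfEqSpan hv hS i : G) = v i := by
  simp [basisOfEqSpan, Module.Basis.span_apply]

lemma eq_span_range_of_basis {S : Submodule ℂ G} (b : Module.Basis (Fin n) ℂ S) :
    S = Submodule.span ℂ (Set.range fun i => (b i : G)) := by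
  have := congrArg (Submodule.map S.subtype) b.span_eq
  rw [Submodule.map_span, ← Set.range_comp, Submodule.map_subtype_top] at this
  exact this.symm

lemma IsChevalley.isContragredient {e f h : Fin n → G} (c : IsChevalley X e f h) (hX : IsUnit X)
    (hk : c.tildeHom.ker = kmRadical X) : IsContragredient X G := by
  have hh := c.linearIndependent_of_ker_le hX hk.le
  refine ⟨component X h, c.isGradedLieAlgebra hX, c.isMinimalGraded hX hk,
    basisOfEqSpan (c.linearIndependent_f hh) (c.component_neg_one hX),
    basisOfEqSpan hh (c.component_zero hX),
    basisOfEqSpan (c.linearIndependent_e hh) (c.component_one hX), ?_⟩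
  simp only [basisOfEqSpan_apply]
  exact ⟨c.e_f, c.h_h, c.h_e, c.h_f⟩

/-- A contragredient Lie algebra is the quotient of `KMTilde X` by the radical: minimality, applied
to a reduced algebra `M`, shows that the kernel contains the radical. -/
lemma IsContragredient.exists_isChevalley (hX : IsUnit X) (hG : IsContragredient X G)
    {M : Type u} [LieRing M] [LieAlgebra ℂ M] {e' f' h' : Fin n → M}
    (c' : IsChevalley X e' f' h') (hk : c'.tildeHom.ker = kmRadical X) :
    ∃ (e f h : Fin n → G) (c : IsChevalley X e f h), c.tildeHom.ker = kmRadical X := by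
  obtain ⟨𝒢, h𝒢, hmin, fB, hB, eB, e_f, h_h, h_e, h_f⟩ := hG
  have hf := eq_span_range_of_basis fB
  have hh := eq_span_range_of_basis hB
  have he := eq_span_range_of_basis eB
  have hloc := localPart_eq_span hf hh he
  have c := h𝒢.isChevalley hloc.le e_f h_h h_e h_f
  refine ⟨_, _, _, c, ?_⟩
  have hlin : LinearIndependent ℂ fun i => (hB i : G) :=
    hB.linearIndependent.map' (𝒢 0).subtype (Submodule.ker_subtype _)
  have hle := c.ker_le_kmRadical hX hlin
  obtain ⟨p, -, hpe, hpf, hph⟩ := c.exists_hom_of_ker_le c' (hle.trans hk.ge)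
  have h𝒢' : ∀ i : ℤ, |i| ≤ 1 → 𝒢 i = component X (fun i => (hB i : G)) i := by
    intro i hi
    obtain rfl | rfl | rfl : i = -1 ∨ i = 0 ∨ i = 1 := by
      rw [abs_le] at hi
      omega
    · exact hf.trans (c.component_neg_one hX).symm
    · exact hh.trans (c.component_zero hX).symm
    · exact he.trans (c.component_one hX).symm
  obtain ⟨ψ, hψ, hψp⟩ := c.exists_localIso c' hX (c'.linearIndependent_of_ker_le hX hk.le)
    hpe hpf hph h𝒢'
  obtain ⟨g, -, hg⟩ := hmin M (component X h') (c'.isGradedLieAlgebra hX) ψ.symm (hψ.symm h𝒢)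
  have key : ∀ x ∈ localPart 𝒢, g (p x) = x := fun x hx => by
    have := hg (ψ ⟨x, hx⟩)
    rwa [LinearEquiv.symm_apply_apply, hψp] at this
  refine le_antisymm hle (hk.ge.trans (c'.ker_tildeHom_le_of_hom c g (fun i => ?_) (fun i => ?_)
    fun i => ?_))
  · rw [← hpe]
    exact key _ (le_localPart 𝒢 (by norm_num) (eB i).2)
  · rw [← hpf]
    exact key _ (le_localPart 𝒢 (by norm_num) (fB i).2)
  · rw [← hph]
    exact key _ (le_localPart 𝒢 (by norm_num) (hB i).2)

end Contragredient

/-! ### The pentad of Cartan type -/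

section Cartan

variable {l : ℕ} {X : Matrix (Fin l) (Fin l) ℂ}

/-- The standard basis of the module `CartanModule D`. -/
def stdBasis {r n : ℕ} (D : Matrix (Fin r) (Fin n) ℂ) : Module.Basis (Fin n) ℂ (CartanModule D) :=
  (Pi.basisFun ℂ (Fin n) : Module.Basis (Fin n) ℂ (Fin n → ℂ))

lemma stdBasis_apply {r n : ℕ} (D : Matrix (Fin r) (Fin n) ℂ) (i j : Fin n) :
    (stdBasis D i : Fin n → ℂ) j = if i = j then 1 else 0 := by
  change (Pi.basisFun ℂ (Fin n) i : Fin n → ℂ) j = _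
  simp [Pi.single_apply, eq_comm]

/-- The rows of an invertible matrix `X` form a basis of `CartanAlgebra l`; the `i`-th row is the
value of the `Φ`-map on the `i`-th standard basis vectors. -/
def corootBasis (hX : IsUnit X) : Module.Basis (Fin l) ℂ (CartanAlgebra l) :=
  ((Pi.basisFun ℂ (Fin l)).map (Matrix.toLinearEquivRight'OfInv
    (Matrix.nonsing_inv_mul X ((Matrix.isUnit_iff_isUnit_det X).1 hX))
    (Matrix.mul_nonsing_inv X ((Matrix.isUnit_iff_isUnit_det X).1 hX))) :
      Module.Basis (Fin l) ℂ (Fin l → ℂ))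

lemma corootBasis_apply (hX : IsUnit X) (i : Fin l) : corootBasis hX i = X i := by
  change Matrix.vecMul (Pi.basisFun ℂ (Fin l) i) X = X i
  rw [Pi.basisFun_apply, Matrix.single_one_vecMul]
  rfl

lemma lie_cartanModule {r n : ℕ} (D : Matrix (Fin r) (Fin n) ℂ) (a : CartanAlgebra r)
    (v : CartanModule D) (j : Fin n) : (⁅a, v⁆ : CartanModule D) j = (∑ i, a i * D i j) * v j :=
  rfl

lemma lie_cartanAlgebra {r : ℕ} (a b : CartanAlgebra r) : ⁅a, b⁆ = 0 := rfl

lemma lie_coroot_stdBasis (hX : IsUnit X) (i j : Fin l) :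
    ⁅corootBasis hX i, stdBasis (1 : Matrix (Fin l) (Fin l) ℂ) j⁆ = X i j • stdBasis 1 j := by
  funext k
  rw [lie_cartanModule, corootBasis_apply]
  change _ = X i j * (stdBasis 1 j : Fin l → ℂ) k
  rw [stdBasis_apply]
  split_ifs with hjk
  · subst hjk
    simp [Matrix.one_apply]
  · simp

lemma lie_coroot_stdBasis_neg (hX : IsUnit X) (i j : Fin l) :
    ⁅corootBasis hX i, stdBasis (-1 : Matrix (Fin l) (Fin l) ℂ) j⁆ =
      -(X i j • stdBasis (-1) j) := by
  funext k
  rw [lie_cartanModule, corootBasis_apply]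
  change _ = -(X i j * (stdBasis (-1) j : Fin l → ℂ) k)
  rw [stdBasis_apply]
  split_ifs with hjk
  · subst hjk
    simp [Matrix.one_apply]
  · simp

lemma cartanForm_apply (a b : CartanAlgebra l) :
    cartanForm X a b = dotProduct (a : Fin l → ℂ) (Matrix.mulVec X.transpose⁻¹ b) :=
  Matrix.toLinearMap₂'_apply' _ _ _

lemma cartanForm_coroot (hX : IsUnit X) (a : CartanAlgebra l) (i : Fin l) :
    cartanForm X a (corootBasis hX i) = a i := by
  have hdet : IsUnit X.transpose.det := by
    rw [Matrix.det_transpose]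
    exact (Matrix.isUnit_iff_isUnit_det X).1 hX
  have : corootBasis hX i = Matrix.mulVec X.transpose (Pi.single i 1) := by
    rw [corootBasis_apply, Matrix.mulVec_single_one]
    rfl
  rw [cartanForm_apply, this, Matrix.mulVec_mulVec, Matrix.nonsing_inv_mul _ hdet,
    Matrix.one_mulVec]
  exact dotProduct_single_one (a : Fin l → ℂ) i

lemma cartanPairing_apply (v : CartanModule (1 : Matrix (Fin l) (Fin l) ℂ))
    (w : CartanModule (-1 : Matrix (Fin l) (Fin l) ℂ)) :
    cartanPairing 1 1 v w = ∑ i, v i * w i :=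
  (Matrix.toLinearMap₂'_apply' _ _ _).trans 
    (congrArg (dotProduct (v : Fin l → ℂ)) (Matrix.one_mulVec (w : Fin l → ℂ)))

lemma lie_cartanModule_one (a : CartanAlgebra l)
    (v : CartanModule (1 : Matrix (Fin l) (Fin l) ℂ)) (j : Fin l) :
    (⁅a, v⁆ : CartanModule (1 : Matrix (Fin l) (Fin l) ℂ)) j = a j * v j := by
  rw [lie_cartanModule]
  congr 1
  exact congrFun (Matrix.vecMul_one (a : Fin l → ℂ)) j

lemma lie_cartanModule_neg_one (a : CartanAlgebra l)
    (v : CartanModule (-1 : Matrix (Fin l) (Fin l) ℂ)) (j : Fin l) :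
    (⁅a, v⁆ : CartanModule (-1 : Matrix (Fin l) (Fin l) ℂ)) j = -(a j * v j) := by
  rw [lie_cartanModule, ← neg_mul]
  congr 1
  refine (congrFun (Matrix.vecMul_neg (a : Fin l → ℂ) 1) j).trans ?_
  exact congrArg Neg.neg (congrFun (Matrix.vecMul_one (a : Fin l → ℂ)) j)

lemma pairing_lie_eq (a : CartanAlgebra l) (i j : Fin l) :
    cartanPairing 1 1 ⁅a, stdBasis (1 : Matrix (Fin l) (Fin l) ℂ) i⁆
      (stdBasis (-1 : Matrix (Fin l) (Fin l) ℂ) j) = if i = j then a i else 0 := by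
  simp only [cartanPairing_apply, lie_cartanModule_one, stdBasis_apply]
  by_cases hij : i = j
  · subst hij
    rw [Finset.sum_eq_single i (fun k _ hk => by simp [Ne.symm hk]) (by simp)]
    simp
  · rw [if_neg hij]
    refine Finset.sum_eq_zero fun k _ => ?_
    by_cases hik : i = k
    · subst hik
      simp [Ne.symm hij]
    · simp [hik]

lemma cartanForm_right (hX : IsUnit X) {b : CartanAlgebra l}
    (hb : ∀ a, cartanForm X a b = 0) : b = 0 := by
  have hdet : IsUnit X.transpose.det := by
    rw [Matrix.det_transpose]
    exact (Matrix.isUnit_iff_isUnit_det X).1 hX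
  have h0 : Matrix.mulVec X.transpose⁻¹ (b : Fin l → ℂ) = 0 := funext fun i =>
    (single_one_dotProduct i _).symm.trans
      ((cartanForm_apply _ _).symm.trans (hb (Pi.single i 1 : Fin l → ℂ)))
  have := congrArg (Matrix.mulVec X.transpose) h0
  rw [Matrix.mulVec_zero] at this
  refine Eq.trans ?_ this
  refine ((Matrix.mulVec_mulVec (b : Fin l → ℂ) _ _).trans ?_).symm
  rw [Matrix.mul_nonsing_inv _ hdet]
  exact Matrix.one_mulVec (b : Fin l → ℂ)

/-- The value of the `Φ`-map on standard basis vectors. -/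
lemma isPhiMap_stdBasis (hX : IsUnit X)
    {Φ : CartanModule (1 : Matrix (Fin l) (Fin l) ℂ) →ₗ[ℂ]
      CartanModule (-1 : Matrix (Fin l) (Fin l) ℂ) →ₗ[ℂ] CartanAlgebra l}
    (hΦ : IsPhiMap (cartanPairing 1 1) (cartanForm X) Φ) (i j : Fin l) :
    Φ (stdBasis 1 i) (stdBasis (-1) j) = if i = j then corootBasis hX i else 0 := by
  rw [← sub_eq_zero]
  refine cartanForm_right hX fun a => ?_
  rw [map_sub, hΦ, pairing_lie_eq]
  split_ifs
  · rw [cartanForm_coroot, sub_self]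
  · rw [map_zero, sub_self]

/-- The `Φ`-map of the pentad of Cartan type with `D` and `Γ` the identity matrices. -/
def cartanPhi (hX : IsUnit X) : CartanModule (1 : Matrix (Fin l) (Fin l) ℂ) →ₗ[ℂ]
    CartanModule (-1 : Matrix (Fin l) (Fin l) ℂ) →ₗ[ℂ] CartanAlgebra l :=
  LinearMap.mk₂ ℂ (fun v w => ∑ i, (v i * w i) • corootBasis hX i)
    (fun v v' w => by
      rw [← Finset.sum_add_distrib]
      exact Finset.sum_congr rfl fun i _ => by rw [← add_smul, ← add_mul]; rfl)
    (fun t v w => by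
      rw [Finset.smul_sum]
      exact Finset.sum_congr rfl fun i _ => by rw [smul_smul, ← mul_assoc]; rfl)
    (fun v w w' => by
      rw [← Finset.sum_add_distrib]
      exact Finset.sum_congr rfl fun i _ => by rw [← add_smul, ← mul_add]; rfl)
    (fun t v w => by
      rw [Finset.smul_sum]
      exact Finset.sum_congr rfl fun i _ => by rw [smul_smul, mul_left_comm]; rfl)

lemma isPhiMap_cartanPhi (hX : IsUnit X) :
    IsPhiMap (cartanPairing 1 1) (cartanForm X) (cartanPhi hX) := by
  intro a v w
  change cartanForm X a (∑ i, (v i * w i) • corootBasis hX i) = _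
  rw [map_sum, cartanPairing_apply]
  refine Finset.sum_congr rfl fun i _ => ?_
  rw [map_smul, cartanForm_coroot, lie_cartanModule_one, smul_eq_mul]
  ring

lemma isStandardPentad_cartan (hl : 1 ≤ l) (hX : IsUnit X) :
    IsStandardPentad (cartanPairing (1 : Matrix (Fin l) (Fin l) ℂ) 1) (cartanForm X) where
  nontrivial := by
    have : Nonempty (Fin l) := ⟨⟨0, hl⟩⟩
    exact inferInstanceAs (Nontrivial (Fin l → ℂ))
  form_left a ha := funext fun i => by rw [← cartanForm_coroot hX a i, ha]; rfl
  form_right _ hb := cartanForm_right hX hb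
  form_invariant a b c := by
    rw [lie_cartanAlgebra, lie_cartanAlgebra, map_zero, map_zero, LinearMap.zero_apply]
  pair_invariant a v w := by
    rw [cartanPairing_apply, cartanPairing_apply, ← Finset.sum_neg_distrib]
    refine Finset.sum_congr rfl fun i _ => ?_
    rw [lie_cartanModule_one]
    rw [lie_cartanModule_neg_one]
    ring
  pair_left v hv := funext fun i => by
    have := hv (stdBasis (-1) i)
    simp only [cartanPairing_apply, stdBasis_apply, mul_ite, mul_one, mul_zero] at this
    exact ((Finset.sum_ite_eq Finset.univ i (v : Fin l → ℂ)).trans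
      (if_pos (Finset.mem_univ i))).symm.trans this
  pair_right w hw := funext fun i => by
    have := hw (stdBasis 1 i)
    simp only [cartanPairing_apply, stdBasis_apply, ite_mul, one_mul, zero_mul] at this
    exact ((Finset.sum_ite_eq Finset.univ i (w : Fin l → ℂ)).trans
      (if_pos (Finset.mem_univ i))).symm.trans this
  exists_phi := ⟨cartanPhi hX, isPhiMap_cartanPhi hX⟩

end Cartan

/-! ### PC Lie algebras -/

section PC

variable {l : ℕ} {X : Matrix (Fin l) (Fin l) ℂ} {L : Type u} [LieRing L] [LieAlgebra ℂ L]

/-- A bilinear description of a bracket may be checked on bases. -/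
lemma lie_eq_of_basis {ι κ A B : Type*} [AddCommGroup A] [Module ℂ A] [AddCommGroup B]
    [Module ℂ B] (ba : Module.Basis ι ℂ A) (bb : Module.Basis κ ℂ B) (p : A →ₗ[ℂ] L)
    (q : B →ₗ[ℂ] L) (r : A →ₗ[ℂ] B →ₗ[ℂ] L)
    (hr : ∀ i j, ⁅p (ba i), q (bb j)⁆ = r (ba i) (bb j)) (a : A) (b : B) :
    ⁅p a, q b⁆ = r a b := by
  have : ((LieModule.toEnd ℂ L L : L →ₗ[ℂ] Module.End ℂ L).compl₁₂ p q) = r :=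
    LinearMap.ext_basis ba bb hr
  exact LinearMap.congr_fun₂ this a b

/-- The case of the action of a Lie algebra on a module. -/
lemma lie_eq_map_lie_of_basis {ι κ A B : Type*} [LieRing A] [LieAlgebra ℂ A] [AddCommGroup B]
    [Module ℂ B] [LieRingModule A B] [LieModule ℂ A B] (ba : Module.Basis ι ℂ A)
    (bb : Module.Basis κ ℂ B) (p : A →ₗ[ℂ] L) (q : B →ₗ[ℂ] L)
    (hr : ∀ i j, ⁅p (ba i), q (bb j)⁆ = q ⁅ba i, bb j⁆) (a : A) (b : B) :
    ⁅p a, q b⁆ = q ⁅a, b⁆ :=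
  lie_eq_of_basis ba bb p q ((LieModule.toEnd ℂ A B : A →ₗ[ℂ] Module.End ℂ B).compr₂ q) hr a b

lemma IsChevalley.isPCLieAlgebra {e f h : Fin l → L} (c : IsChevalley X e f h) (hl : 1 ≤ l)
    (hX : IsUnit X) (hk : c.tildeHom.ker = kmRadical X) : IsPCLieAlgebra l l X 1 1 L := by
  have hh := c.linearIndependent_of_ker_le hX hk.le
  have hr := c.isReduced_of_ker_eq hX hk
  let ιW := (stdBasis (-1 : Matrix (Fin l) (Fin l) ℂ)).equiv
    (basisOfEqSpan (c.linearIndependent_f hh) (c.component_neg_one hX)) (Equiv.refl _)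
  let ι𝔤 := (corootBasis hX).equiv (basisOfEqSpan hh (c.component_zero hX)) (Equiv.refl _)
  let ιV := (stdBasis (1 : Matrix (Fin l) (Fin l) ℂ)).equiv
    (basisOfEqSpan (c.linearIndependent_e hh) (c.component_one hX)) (Equiv.refl _)
  have hW : ∀ i, (ιW (stdBasis _ i) : L) = f i := fun i => by
    simp [ιW, basisOfEqSpan_apply]
  have h𝔤 : ∀ i, (ι𝔤 (corootBasis hX i) : L) = h i := fun i => by
    simp [ι𝔤, basisOfEqSpan_apply]
  have hV : ∀ i, (ιV (stdBasis _ i) : L) = e i := fun i => by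
    simp [ιV, basisOfEqSpan_apply]
  let pW : CartanModule (-1 : Matrix (Fin l) (Fin l) ℂ) →ₗ[ℂ] L :=
    (component X h (-1)).subtype ∘ₗ ιW.toLinearMap
  let p𝔤 : CartanAlgebra l →ₗ[ℂ] L := (component X h 0).subtype ∘ₗ ι𝔤.toLinearMap
  let pV : CartanModule (1 : Matrix (Fin l) (Fin l) ℂ) →ₗ[ℂ] L :=
    (component X h 1).subtype ∘ₗ ιV.toLinearMap
  refine ⟨hl, hl, hX, Matrix.isDiag_one, isUnit_one, isStandardPentad_cartan hl hX,
    component X h, c.isGradedLieAlgebra hX, ⟨ιW, ι𝔤, ιV, fun a b => ?_, ?_, ?_, cartanPhi hX,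
      isPhiMap_cartanPhi hX, ?_⟩, fun k hk x hx hx' => ?_, fun k hk x hx hx' => ?_⟩
  · refine lie_eq_map_lie_of_basis (corootBasis hX) (corootBasis hX) p𝔤 p𝔤 (fun i j => ?_) a b
    change ⁅(ι𝔤 (corootBasis hX i) : L), (ι𝔤 (corootBasis hX j) : L)⁆ =
      ι𝔤 ⁅corootBasis hX i, corootBasis hX j⁆
    rw [h𝔤, h𝔤, c.h_h, lie_cartanAlgebra, map_zero, Submodule.coe_zero]
  · exact lie_eq_map_lie_of_basis (corootBasis hX) (stdBasis 1) p𝔤 pV fun i j => by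
      change ⁅(ι𝔤 (corootBasis hX i) : L), (ιV (stdBasis 1 j) : L)⁆ =
        ιV ⁅corootBasis hX i, stdBasis 1 j⁆
      rw [h𝔤, hV, c.h_e, lie_coroot_stdBasis, map_smul, Submodule.coe_smul, hV]
  · exact lie_eq_map_lie_of_basis (corootBasis hX) (stdBasis (-1)) p𝔤 pW fun i j => by
      change ⁅(ι𝔤 (corootBasis hX i) : L), (ιW (stdBasis (-1) j) : L)⁆ =
        ιW ⁅corootBasis hX i, stdBasis (-1) j⁆
      rw [h𝔤, hW, c.h_f, lie_coroot_stdBasis_neg, map_neg, map_smul, Submodule.coe_neg,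
        Submodule.coe_smul, hW]
  · exact lie_eq_of_basis (stdBasis 1) (stdBasis (-1)) pV pW ((cartanPhi hX).compr₂ p𝔤)
      fun i j => by
        change ⁅(ιV (stdBasis 1 i) : L), (ιW (stdBasis (-1) j) : L)⁆ =
          ι𝔤 (cartanPhi hX (stdBasis 1 i) (stdBasis (-1) j))
        rw [hV, hW, c.e_f, isPhiMap_stdBasis hX (isPhiMap_cartanPhi hX)]
        split_ifs
        · rw [h𝔤]
        · simp
  · exact c.eq_zero_of_lie_f_eq_zero hX hr hk hx fun i => hx' _ (c.f_mem_component hX i)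
  · exact c.eq_zero_of_lie_e_eq_zero hX hr hk hx fun i => hx' _ (c.e_mem_component hX i)

lemma iteratedBrackets_le_of_graded {ℒ : ℤ → Submodule ℂ L} (hℒ : IsGradedLieAlgebra ℒ)
    {n : ℕ} {v : Fin n → L} {d : ℤ} (hv : ∀ i, v i ∈ ℒ d) (k : ℕ) :
    iteratedBrackets v k ≤ ℒ ((k + 1) * d) := by
  induction k with
  | zero =>
    refine Submodule.span_le.2 ?_
    rintro _ ⟨i, rfl⟩
    simpa using hv i
  | succ k ih =>
    refine iteratedBrackets_succ_le fun i x hx => ?_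
    have := hℒ.lie_mem _ _ _ (hv i) _ (ih hx)
    rwa [show d + ((k : ℤ) + 1) * d = ((k + 1 : ℕ) + 1) * d by push_cast; ring] at this

/-- The gradation by eigenvalues is finer than any gradation with the generators in degrees
`1`, `-1`, `0`. -/
lemma IsChevalley.component_le_of_graded {e f h : Fin l → L} (c : IsChevalley X e f h)
    (hX : IsUnit X) {ℒ : ℤ → Submodule ℂ L} (hℒ : IsGradedLieAlgebra ℒ) (he : ∀ i, e i ∈ ℒ 1)
    (hf : ∀ i, f i ∈ ℒ (-1)) (hh : ∀ i, h i ∈ ℒ 0) (k : ℤ) : component X h k ≤ ℒ k := by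
  rw [c.component_eq hX]
  match k with
  | Int.ofNat 0 =>
    refine Submodule.span_le.2 ?_
    rintro _ ⟨i, rfl⟩
    exact hh i
  | Int.ofNat (k + 1) =>
    have := iteratedBrackets_le_of_graded hℒ he k
    rwa [mul_one] at this
  | Int.negSucc k =>
    have := iteratedBrackets_le_of_graded hℒ hf k
    rwa [mul_neg_one] at this

/-- A PC Lie algebra is the quotient of `KMTilde X` by the radical, since it is transitive. -/
lemma IsPCLieAlgebra.exists_isChevalley (hX : IsUnit X) (hL : IsPCLieAlgebra l l X 1 1 L) :
    ∃ (e f h : Fin l → L) (c : IsChevalley X e f h), c.tildeHom.ker = kmRadical X := by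
  obtain ⟨-, -, -, -, -, -, ℒ, hℒ, ⟨ιW, ι𝔤, ιV, h1, h2, h3, Φ, hΦ, h4⟩, ht, ht'⟩ := hL
  let fB := (stdBasis (-1 : Matrix (Fin l) (Fin l) ℂ)).map ιW
  let hB := (corootBasis hX).map ι𝔤
  let eB := (stdBasis (1 : Matrix (Fin l) (Fin l) ℂ)).map ιV
  have hf := eq_span_range_of_basis fB
  have hh := eq_span_range_of_basis hB
  have he := eq_span_range_of_basis eB
  have hloc := localPart_eq_span hf hh he
  have c : IsChevalley X (fun i => (eB i : L)) (fun i => (fB i : L)) fun i => (hB i : L) := by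
    refine hℒ.isChevalley hloc.le (fun i j => ?_) (fun i j => ?_) (fun i j => ?_) fun i j => ?_
    · simp only [eB, fB, hB, Module.Basis.map_apply]
      rw [h4, isPhiMap_stdBasis hX hΦ]
      split_ifs <;> simp
    · simp only [hB, Module.Basis.map_apply]
      rw [h1, lie_cartanAlgebra, map_zero, Submodule.coe_zero]
    · simp only [eB, hB, Module.Basis.map_apply]
      rw [h2, lie_coroot_stdBasis, map_smul, Submodule.coe_smul]
    · simp only [fB, hB, Module.Basis.map_apply]
      rw [h3, lie_coroot_stdBasis_neg, map_neg, map_smul, Submodule.coe_neg, Submodule.coe_smul]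
  have hlin : LinearIndependent ℂ fun i => (hB i : L) :=
    hB.linearIndependent.map' (ℒ 0).subtype (Submodule.ker_subtype _)
  have hle := c.component_le_of_graded hX hℒ (fun i => (eB i).2) (fun i => (fB i).2)
    fun i => (hB i).2
  refine ⟨_, _, _, c, c.ker_eq_of_isReduced hX hlin (c.isReduced_of_transitive hX hlin
    (fun k hk x hx hx' => ht k hk x (hle k hx) fun y hy => ?_)
    fun k hk x hx hx' => ht' k hk x (hle k hx) fun y hy => ?_)⟩
  · rw [hf] at hy
    exact lie_mem_of_mem_span (S := ⊥) hy (by rintro _ ⟨i, rfl⟩; exact hx' i)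
  · rw [he] at hy
    exact lie_mem_of_mem_span (S := ⊥) hy (by rintro _ ⟨i, rfl⟩; exact hx' i)

end PC

/-! ### The Kac–Moody algebra and its lifts to other universes -/

section KacMoody

variable {n : ℕ} {X : Matrix (Fin n) (Fin n) ℂ}

lemma isChevalley_kacMoody (X : Matrix (Fin n) (Fin n) ℂ) :
    ∃ (e f h : Fin n → KacMoody X) (c : IsChevalley X e f h), c.tildeHom.ker = kmRadical X := by
  refine ⟨_, _, _, (isChevalley_tilde X).map (quotientHom_surjective (kmRadical X)), ?_⟩
  have hid : LieHom.id = (isChevalley_tilde X).tildeHom :=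
    (isChevalley_tilde X).eq_tildeHom (fun _ => rfl) (fun _ => rfl) fun _ => rfl
  rw [(isChevalley_tilde X).tildeHom_map (quotientHom_surjective (kmRadical X)), ← hid]
  ext x
  exact quotientHom_eq_zero

/-- The quotient of `KMTilde X` by the radical has copies in every universe. -/
lemma IsChevalley.exists_universe_copy {M : Type} [LieRing M] [LieAlgebra ℂ M] {e f h : Fin n → M}
    (c : IsChevalley X e f h) :
    ∃ (M' : Type u) (_ : LieRing M') (_ : LieAlgebra ℂ M') (e' f' h' : Fin n → M')
      (c' : IsChevalley X e' f' h'), c'.tildeHom.ker = c.tildeHom.ker := by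
  let E : ULift.{u} M ≃ₗ[ℂ] M := ULift.moduleEquiv
  let _ : LieRing (ULift.{u} M) := E.toAddEquiv.lieRing
  let _ : LieAlgebra ℂ (ULift.{u} M) := E.lieAlgebra
  let φ : M →ₗ⁅ℂ⁆ ULift.{u} M := (LinearEquiv.lieEquiv ℂ E).symm.toLieHom
  have hφ : Function.Bijective φ := (LinearEquiv.lieEquiv ℂ E).symm.bijective
  refine ⟨ULift.{u} M, inferInstance, inferInstance, _, _, _, c.map hφ.2, ?_⟩
  rw [c.tildeHom_map hφ.2]
  ext x
  rw [LieHom.mem_ker, LieHom.mem_ker, LieHom.comp_apply, map_eq_zero_iff φ hφ.1]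

end KacMoody

end PentadLie

end

theorem mainTheorem2 (l : ℕ) (hl : 1 ≤ l) (X : Matrix (Fin l) (Fin l) ℂ) (hX : IsUnit X) :
    (∃ (G : Type u) (_ : LieRing G) (_ : LieAlgebra ℂ G), PentadLie.IsContragredient X G) ∧
    (∃ (L : Type u) (_ : LieRing L) (_ : LieAlgebra ℂ L),
      PentadLie.IsPCLieAlgebra l l X 1 1 L) ∧
    (∀ (G L : Type u) [LieRing G] [LieAlgebra ℂ G] [LieRing L] [LieAlgebra ℂ L],
      PentadLie.IsContragredient X G → PentadLie.IsPCLieAlgebra l l X 1 1 L →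
        Nonempty (G ≃ₗ⁅ℂ⁆ L)) ∧
    (PentadLie.IsGeneralizedCartanMatrix X →
      ∀ (L : Type u) [LieRing L] [LieAlgebra ℂ L],
        PentadLie.IsPCLieAlgebra l l X 1 1 L →
          Nonempty (PentadLie.KacMoody X ≃ₗ⁅ℂ⁆ L)) := by
  obtain ⟨_, _, _, c₀, hc₀⟩ := PentadLie.isChevalley_kacMoody X
  obtain ⟨M, _, _, e, f, h, c, hc⟩ := c₀.exists_universe_copy
  replace hc := hc.trans hc₀
  refine ⟨⟨M, _, _, c.isContragredient hX hc⟩, ⟨M, _, _, c.isPCLieAlgebra hl hX hc⟩, ?_, ?_⟩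
  · intro G L _ _ _ _ hG hL
    obtain ⟨_, _, _, cG, hcG⟩ := hG.exists_isChevalley hX c hc
    obtain ⟨_, _, _, cL, hcL⟩ := hL.exists_isChevalley hX
    exact ⟨(PentadLie.quotientEquiv cG.tildeHom_surjective hcG).symm.trans
      (PentadLie.quotientEquiv cL.tildeHom_surjective hcL)⟩
  · intro _ L _ _ hL
    obtain ⟨_, _, _, cL, hcL⟩ := hL.exists_isChevalley hX
    exact ⟨PentadLie.quotientEquiv cL.tildeHom_surjective hcL⟩
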